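/- A $\mathbb Z[\mathbb Z_2]$-module is an abelian group with an action of $\mathbb Z_2=\{1,\nu\}$. For a $\mathbb Z_2$-CW complex $X$ (cells permuted by the action) with cellular chain complex $C_\bullet(X)$, regarded as a complex of $\mathbb Z[\mathbb Z_2]$-modules, and for a $\mathbb Z[\mathbb Z_2]$-module $N$, the Bredon cohomology $H^\bullet_{\mathbb Z_2}(X;N)$ is the cohomology of the cochain complex $\operatorname{Hom}_{\mathbb Z[\mathbb Z_2]}(C_\bullet(X),N)$. If $X=|K|$ for a simplicial set $K$ with a simplicial involution, $C_\bullet(X)$ is free on the nondegenerate simplices of $K$, with the alternating sum of the faces as boundary. For the topological torus $T^n=(S^1)^n$ the group $H^\bullet_{\mathbb Z_2}(T^n;N)$ is that of $|\operatorname{Sing}(T^n)|$, its canonical $\mathbb Z_2$-CW approximation. Let $\mathbb Z_2$ act on $T^n\subset\mathbb C^n$ by $\nu\cdot(z_1,\dots,z_n)=(-z_1,\dots,-z_n)$, and on $\pi_2(S^2)$ by the action induced by the antipodal map of $S^2$. For $L>0$ divisible by $4$, let $\Gamma_L$ be the order complex of the poset on $\mathbb Z/L$ in which $a\prec b$ if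 and only if $a$ is even, $b$ is odd and $a-b=\pm1$; its $n$-th power $\Gamma_L^n$, with the involution that adds $L/2$ to each coordinate, is a $\mathbb Z_2$-equivariant triangulation of $T^n$. **Proposition.** As a $\mathbb Z[\mathbb Z_2]$-module, $\pi_2(S^2)\cong\mathfrak Z_-$, the group $\mathbb Z$ with $\nu\cdot m=-m$. For all $n,d\ge 1$ there is an isomorphism of abelian groups $$H^d_{\mathbb Z_2}\bigl(T^n;\pi_2(S^2)\bigr)\;\cong\;\mathbb Z_2^{\binom{n-1}{d-1}} .$$ The same holds with the cellular chains of the triangulation: $H^d_{\mathbb Z_2}\bigl(\Gamma_L^n;\pi_2(S^2)\bigr)\cong\mathbb Z_2^{\binom{n-1}{d-1}}$ for every $L>0$ divisible by $4$. -/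

import Mathlib

namespace BredonTorus

open CategoryTheory Simplicial
open scoped Topology Topology.Homotopy unitInterval

noncomputable section

/-! ### Modules over the group ring `ℤ[ℤ/2]`

A `ℤ[ℤ/2]`-module is an abelian group with an action of `ℤ/2`, that is, an object of
`Rep ℤ Z2`. Its `ℤ/2`-action is determined by the additive involution by which the generator
`ν` acts. -/

/-- The group of order two, written multiplicatively. -/
abbrev Z2 : Type := Multiplicative (ZMod 2)

/-- The generator of `Z2`. -/
abbrev nu : Z2 := Multiplicative.ofAdd 1

theorem Z2.eq_one_or_nu (g : Z2) : g = 1 ∨ g = nu := by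
  revert g; decide

/-- The representation of `Z2` on `M` whose generator acts by the additive involution `s`. -/
def involutionRep {M : Type} [AddCommGroup M] [Module ℤ M] (s : M →ₗ[ℤ] M) (hs : s * s = 1) :
    Representation ℤ Z2 M where
  toFun g := if g = nu then s else 1
  map_one' := if_neg (by decide)
  map_mul' g h := by
    have hne : (1 : Z2) ≠ nu := by decide
    have hnn : nu * nu = (1 : Z2) := by decide
    rcases Z2.eq_one_or_nu g with rfl | rfl <;> rcases Z2.eq_one_or_nu h with rfl | rfl <;>
      simp [hne, hnn, hs]

@[simp]
theorem involutionRep_nu {M : Type} [AddCommGroup M] [Module ℤ M] (s : M →ₗ[ℤ] M) (hs : s * s = 1) :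
    involutionRep s hs nu = s := by
  change (if nu = nu then s else 1) = s
  exact if_pos rfl

/-- A linear map that commutes with the involutions is a map of `ℤ[ℤ/2]`-modules. -/
def involutionRepHom {M N : Type} [AddCommGroup M] [Module ℤ M] [AddCommGroup N] [Module ℤ N]
    {s : M →ₗ[ℤ] M} {hs : s * s = 1} {t : N →ₗ[ℤ] N} {ht : t * t = 1}
    (f : M →ₗ[ℤ] N) (hf : f ∘ₗ s = t ∘ₗ f) :
    Rep.of (involutionRep s hs) ⟶ Rep.of (involutionRep t ht) :=
  Rep.ofHom ⟨f, fun g => by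
    have hne : (1 : Z2) ≠ nu := by decide
    rcases Z2.eq_one_or_nu g with rfl | rfl
    · simp [involutionRep, hne]; rfl
    · simpa using hf⟩

/-- The module `ℤ₋`: the abelian group `ℤ` with `ν` acting as multiplication by `-1`. -/
def Zminus : Rep.{0} ℤ Z2 :=
  Rep.of (involutionRep (M := ℤ) (-1) (by simp))

/-! ### Simplicial sets with involution and Bredon cohomology -/

/-- A simplicial set with a simplicial `ℤ/2`-action, given by the involution `ν`. -/
structure Z2SSet where
  /-- the underlying simplicial set -/
  K : SSet.{0}
  /-- the action of the generator -/
  ν : K ⟶ K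
  ν_comp_ν : ν ≫ ν = 𝟙 K

namespace Z2SSet

/-- The cellular chain complex, with coefficients in `ℤ`, of the CW complex `|K|`: this CW complex
has one `d`-cell for each nondegenerate `d`-simplex of `K`, the group of `d`-chains is free on the
nondegenerate `d`-simplices, and `∂σ = ∑ᵢ (-1)ⁱ dᵢσ`, where degenerate faces count as zero. -/
def cellularChains (X : Z2SSet) : ChainComplex (ModuleCat.{0} ℤ) ℕ :=
  X.K.normalizedChainComplex (ModuleCat.of ℤ ℤ)

/-- The action of `ν` on the cellular chains, `σ ↦ ν · σ` on the simplices. -/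
def chainInvolution (X : Z2SSet) : X.cellularChains ⟶ X.cellularChains :=
  SSet.normalizedChainComplexMap X.ν (ModuleCat.of ℤ ℤ)

theorem chainInvolution_comp_self (X : Z2SSet) :
    X.chainInvolution ≫ X.chainInvolution = 𝟙 X.cellularChains := by
  have h := (SSet.normalizedChainComplexFunctorObj (ModuleCat.of ℤ ℤ)).map_comp X.ν X.ν
  rw [X.ν_comp_ν, CategoryTheory.Functor.map_id] at h
  exact h.symm

theorem chainInvolution_mul_self (X : Z2SSet) (d : ℕ) :
    (X.chainInvolution.f d).hom * (X.chainInvolution.f d).hom = 1 := by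
  have h := congrArg (fun φ => (φ.f d).hom) X.chainInvolution_comp_self
  exact h

/-- The group of cellular `d`-chains of `|K|` as a `ℤ[ℤ/2]`-module. -/
def equivariantChainsX (X : Z2SSet) (d : ℕ) : Rep.{0} ℤ Z2 :=
  Rep.of (involutionRep (X.chainInvolution.f d).hom (X.chainInvolution_mul_self d))

/-- The differential of the cellular chains as a map of `ℤ[ℤ/2]`-modules. -/
def equivariantChainsD (X : Z2SSet) (i j : ℕ) :
    X.equivariantChainsX i ⟶ X.equivariantChainsX j :=
  involutionRepHom (X.cellularChains.d i j).hom
    (congrArg ModuleCat.Hom.hom (X.chainInvolution.comm i j))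

/-- The cellular chains of `|K|` as a chain complex of `ℤ[ℤ/2]`-modules. -/
def equivariantChains (X : Z2SSet) : ChainComplex (Rep.{0} ℤ Z2) ℕ where
  X := X.equivariantChainsX
  d := X.equivariantChainsD
  shape i j hij := by
    refine Rep.hom_ext (DFunLike.ext _ _ fun x => ?_)
    exact LinearMap.congr_fun (congrArg ModuleCat.Hom.hom (X.cellularChains.shape i j hij)) x
  d_comp_d' i j k _ _ := by
    refine Rep.hom_ext (DFunLike.ext _ _ fun x => ?_)
    exact LinearMap.congr_fun (congrArg ModuleCat.Hom.hom (X.cellularChains.d_comp_d i j k)) x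

/-- The equivariant cochain complex `Hom_{ℤ[ℤ/2]}(C_•(|K|), N)`. -/
def equivariantCochains (X : Z2SSet) (N : Rep.{0} ℤ Z2) : CochainComplex (ModuleCat.{0} ℤ) ℕ :=
  X.equivariantChains.linearYonedaObj ℤ N

/-- The Bredon cohomology group `H^d_{ℤ/2}(|K|; N)`. -/
def bredonCohomology (X : Z2SSet) (N : Rep.{0} ℤ Z2) (d : ℕ) : ModuleCat.{0} ℤ :=
  (X.equivariantCochains N).homology d

end Z2SSet

/-! ### The torus -/

/-- The singular simplicial set of a space with a continuous involution. -/
def singular (X : Type) [TopologicalSpace X] (ν : C(X, X)) (hν : ν.comp ν = ContinuousMap.id X) :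
    Z2SSet where
  K := TopCat.toSSet.obj (TopCat.of X)
  ν := TopCat.toSSet.map (TopCat.ofHom ν)
  ν_comp_ν := by
    rw [← CategoryTheory.Functor.map_comp, ← TopCat.ofHom_comp, hν, TopCat.ofHom_id,
      CategoryTheory.Functor.map_id]

/-- The torus `T^n = (S¹)^n` with the antipodal action `ν · (z₁, …, zₙ) = (-z₁, …, -zₙ)`, through
its singular simplices; `|Sing T^n|` is the canonical `ℤ/2`-CW approximation of `T^n`. -/
def torus (n : ℕ) : Z2SSet :=
  singular (Fin n → Circle) ⟨fun z => -z, continuous_neg⟩ (by ext z; simp)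

/-- The set `ℤ/L`, to be ordered as a fence. -/
structure Fence (L : ℕ) where
  /-- the underlying residue class -/
  val : ZMod L

namespace Fence

variable {L : ℕ}

/-- `a ≺ b` if and only if `a` is even, `b` is not, and `a - b = ± 1`. -/
instance : PartialOrder (Fence L) where
  le a b := a = b ∨
    (Even a.val ∧ ¬ Even b.val ∧ (a.val - b.val = 1 ∨ a.val - b.val = -1))
  le_refl a := Or.inl rfl
  le_trans a b c := by
    rintro (rfl | ⟨h1, h2, h3⟩) (rfl | ⟨h4, h5, h6⟩)
    · exact Or.inl rfl
    · exact Or.inr ⟨h4, h5, h6⟩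
    · exact Or.inr ⟨h1, h2, h3⟩
    · exact absurd h4 h2
  le_antisymm a b := by
    rintro (h | ⟨h1, h2, -⟩) (h' | ⟨h3, -, -⟩)
    · exact h
    · exact h
    · exact h'.symm
    · exact absurd h3 h2

theorem le_iff (a b : Fence L) : a ≤ b ↔ a = b ∨
    (Even a.val ∧ ¬ Even b.val ∧ (a.val - b.val = 1 ∨ a.val - b.val = -1)) :=
  Iff.rfl

/-- The involution `x ↦ x + L/2`. -/
def shift (a : Fence L) : Fence L :=
  ⟨a.val + ((L / 2 : ℕ) : ZMod L)⟩

theorem half_add_half (hL : 4 ∣ L) : ((L / 2 : ℕ) : ZMod L) + ((L / 2 : ℕ) : ZMod L) = 0 := by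
  rw [← Nat.cast_add, show L / 2 + L / 2 = L by omega, ZMod.natCast_self]

theorem even_half (hL : 4 ∣ L) : Even ((L / 2 : ℕ) : ZMod L) := by
  obtain ⟨k, rfl⟩ := hL
  exact ⟨(k : ZMod (4 * k)), by
    rw [show 4 * k / 2 = k + k by omega, Nat.cast_add]⟩

theorem shift_shift (hL : 4 ∣ L) (a : Fence L) : a.shift.shift = a := by
  cases a
  simp [shift, add_assoc, half_add_half hL]

theorem even_shift (hL : 4 ∣ L) (a : Fence L) : Even a.shift.val ↔ Even a.val := by
  constructor
  · intro h
    have := h.add (even_half hL)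
    simpa [shift, add_assoc, half_add_half hL] using this
  · intro h
    exact h.add (even_half hL)

theorem shift_monotone (hL : 4 ∣ L) : Monotone (shift : Fence L → Fence L) := by
  rintro a b (rfl | ⟨h1, h2, h3⟩)
  · exact le_rfl
  · refine Or.inr ⟨(even_shift hL a).2 h1, fun h => h2 ((even_shift hL b).1 h), ?_⟩
    simpa [shift] using h3

end Fence

/-- The simplicial set `Γ_L^n`, a triangulation of `T^n`, for `L > 0` divisible by `4`: the order
complex of the `n`-th power (with the componentwise order) of the fence poset on `ℤ/L`. The
involution adds `L/2` to every coordinate. -/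
def torusTriangulation (L : ℕ) (hL : 4 ∣ L) (n : ℕ) : Z2SSet where
  K := PartOrd.nerveFunctor.obj (PartOrd.of (Fin n → Fence L))
  ν := PartOrd.nerveFunctor.map (PartOrd.ofHom
    ⟨fun u i => (u i).shift, fun _ _ h i => Fence.shift_monotone hL (h i)⟩)
  ν_comp_ν := by
    rw [← CategoryTheory.Functor.map_comp, ← CategoryTheory.Functor.map_id]
    refine congrArg _ (PartOrd.ext fun u => ?_)
    funext i
    exact Fence.shift_shift hL (u i)

/-! ### The homotopy group `π₂(S²)` with its action -/

/-- A continuous map `f` with `f x = y` acts on generalized loops by composition. -/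
def genLoopMap {X Y : Type} [TopologicalSpace X] [TopologicalSpace Y] {N : Type}
    (f : C(X, Y)) {x : X} {y : Y} (hf : f x = y) (p : Ω^ N X x) : Ω^ N Y y :=
  ⟨f.comp p.1, fun u hu => by
    rw [ContinuousMap.comp_apply, p.2 u hu, hf]⟩

/-- The homomorphism `π₂(X, x) → π₂(Y, y)` induced by a continuous map `f` with `f x = y`, with the
homotopy groups written additively. -/
def pi2Map {X Y : Type} [TopologicalSpace X] [TopologicalSpace Y]
    (f : C(X, Y)) {x : X} {y : Y} (hf : f x = y) :
    Additive (π_ 2 X x) →+ Additive (π_ 2 Y y) :=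
  MonoidHom.toAdditive
    { toFun := Quotient.map (genLoopMap f hf)
        (fun _ _ h => ContinuousMap.HomotopicRel.comp_continuousMap h f)
      map_one' := by
        refine congrArg (Quotient.mk _) (GenLoop.ext _ _ fun u => ?_)
        exact hf
      map_mul' := by
        rintro ⟨p⟩ ⟨q⟩
        have h1 := HomotopyGroup.mul_spec (i := (0 : Fin 2)) (p := p) (q := q)
        have h2 := HomotopyGroup.mul_spec (i := (0 : Fin 2))
          (p := genLoopMap f hf p) (q := genLoopMap f hf q)
        refine (congrArg (Quotient.map (genLoopMap f hf)
          (fun _ _ h => ContinuousMap.HomotopicRel.comp_continuousMap h f)) h1).trans (Eq.trans ?_ h2.symm)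
        refine congrArg (Quotient.mk _) (GenLoop.ext _ _ fun u => ?_)
        change f (ite _ _ _) = ite _ _ _
        split_ifs <;> rfl }

theorem pi2Map_mk {X Y : Type} [TopologicalSpace X] [TopologicalSpace Y]
    (f : C(X, Y)) {x : X} {y : Y} (hf : f x = y) (p : Ω^ (Fin 2) X x) :
    pi2Map f hf (Additive.ofMul (Quotient.mk _ p : π_ 2 X x)) =
      Additive.ofMul (Quotient.mk _ (genLoopMap f hf p) : π_ 2 Y y) :=
  rfl

/-- The unit sphere in `ℝ³`. -/
abbrev S2 : Type := Metric.sphere (0 : EuclideanSpace ℝ (Fin 3)) 1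

theorem mem_S2_iff (v : EuclideanSpace ℝ (Fin 3)) :
    v ∈ Metric.sphere (0 : EuclideanSpace ℝ (Fin 3)) 1 ↔ v 0 ^ 2 + v 1 ^ 2 + v 2 ^ 2 = 1 := by
  rw [mem_sphere_zero_iff_norm, EuclideanSpace.norm_eq, Real.sqrt_eq_one, Fin.sum_univ_three]
  simp

/-- The base point `(1, 0, 0)` of the sphere. -/
def basePoint : S2 :=
  ⟨!₂[1, 0, 0], by rw [mem_S2_iff]; simp⟩

/-- The antipodal map `x ↦ -x` of the sphere. -/
def antipode : C(S2, S2) :=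
  ⟨fun x => -x, continuous_neg⟩

/-- The rotation of the sphere by the angle `θ` about the third coordinate axis. -/
def rotation (θ : ℝ) (x : S2) : S2 :=
  ⟨!₂[Real.cos θ * x.1 0 - Real.sin θ * x.1 1, Real.sin θ * x.1 0 + Real.cos θ * x.1 1, x.1 2], by
    have h := (mem_S2_iff x.1).1 x.2
    rw [mem_S2_iff]
    simp only [Matrix.cons_val]
    linear_combination h + (x.1 0 ^ 2 + x.1 1 ^ 2) * Real.sin_sq_add_cos_sq θ⟩

theorem continuous_rotation : Continuous fun q : ℝ × S2 => rotation q.1 q.2 := by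
  refine Continuous.subtype_mk ((PiLp.continuous_toLp 2 _).comp (continuous_pi fun i => ?_)) _
  fin_cases i <;> simp <;> fun_prop

/-- The antipodal map followed by the half turn that brings `-basePoint` back to `basePoint`. -/
def basedAntipode : C(S2, S2) :=
  ⟨fun x => rotation Real.pi (antipode x),
    Continuous.comp (g := fun q : ℝ × S2 => rotation q.1 q.2)
      (f := fun x : S2 => (Real.pi, antipode x)) continuous_rotation (by fun_prop)⟩

theorem basedAntipode_basePoint : basedAntipode basePoint = basePoint := by
  apply Subtype.ext
  ext i
  fin_cases i <;> simp [basedAntipode, rotation, antipode, basePoint]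

theorem basedAntipode_basedAntipode (x : S2) : basedAntipode (basedAntipode x) = x := by
  apply Subtype.ext
  ext i
  fin_cases i <;> simp [basedAntipode, rotation, antipode]

/-- The additive map by which `ν` acts on `π₂(S², basePoint)`: the homomorphism
`π₂(S², basePoint) → π₂(S², -basePoint)` induced by the antipodal map, followed by the
identification `π₂(S², -basePoint) → π₂(S², basePoint)` along the half great circle
`t ↦ rotation (π t) (-basePoint)`. This identification sends the class of `q` to the class of the
end of any homotopy that starts at `q` and moves the boundary of the square along the path; the
homotopy `t ↦ rotation (π t) ∘ q` is of this kind, see `exists_transport`. -/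
def pi2Involution : Additive (π_ 2 S2 basePoint) →ₗ[ℤ] Additive (π_ 2 S2 basePoint) :=
  (pi2Map basedAntipode basedAntipode_basePoint).toIntLinearMap

theorem rotation_zero (x : S2) : rotation 0 x = x := by
  apply Subtype.ext
  ext i
  fin_cases i <;> simp [rotation]

/-- The homotopy `(t, u) ↦ rotation (π t) (-p u)`. -/
def transportHomotopy (p : Ω^ (Fin 2) S2 basePoint) : C(I × (I^ Fin 2), S2) :=
  ⟨fun z => rotation (Real.pi * z.1) (antipode (p.1 z.2)),
    Continuous.comp (g := fun q : ℝ × S2 => rotation q.1 q.2)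
      (f := fun z : I × (I^ Fin 2) => (Real.pi * (z.1 : ℝ), antipode (p.1 z.2)))
      continuous_rotation (by fun_prop)⟩

theorem transportHomotopy_apply (p : Ω^ (Fin 2) S2 basePoint) (t : I) (u : I^ Fin 2) :
    transportHomotopy p (t, u) = rotation (Real.pi * t) (antipode (p u)) :=
  rfl

/-- The loop that represents `ν · [p]` is the end of a homotopy that starts at `ν ∘ p` and moves the
boundary of the square along the half great circle from `-basePoint` to `basePoint`. -/
theorem exists_transport (p : Ω^ (Fin 2) S2 basePoint) :
    ∃ q : Ω^ (Fin 2) S2 basePoint,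
      pi2Involution (Additive.ofMul (Quotient.mk _ p : π_ 2 S2 basePoint)) =
        Additive.ofMul (Quotient.mk _ q : π_ 2 S2 basePoint) ∧
      ∃ H : C(I × (I^ Fin 2), S2),
        (∀ u, H (0, u) = antipode (p u)) ∧ (∀ u, H (1, u) = q u) ∧
        ∀ t, ∀ u ∈ Cube.boundary (Fin 2),
          H (t, u) = rotation (Real.pi * t) (antipode basePoint) := by
  refine ⟨genLoopMap basedAntipode basedAntipode_basePoint p, rfl, transportHomotopy p,
    fun u => ?_, fun u => ?_, fun t u hu => ?_⟩
  · rw [transportHomotopy_apply, Set.Icc.coe_zero, mul_zero, rotation_zero]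
  · rw [transportHomotopy_apply, Set.Icc.coe_one, mul_one]
    rfl
  · rw [transportHomotopy_apply, GenLoop.boundary p u hu]

theorem pi2Involution_mul_self : pi2Involution * pi2Involution = 1 := by
  refine LinearMap.ext fun c => ?_
  obtain ⟨p, rfl⟩ : ∃ p : Ω^ (Fin 2) S2 basePoint,
      Additive.ofMul (Quotient.mk _ p : π_ 2 S2 basePoint) = c :=
    Quotient.exists_rep (Additive.toMul c)
  change Additive.ofMul (Quotient.mk _ (genLoopMap basedAntipode basedAntipode_basePoint
    (genLoopMap basedAntipode basedAntipode_basePoint p)) : π_ 2 S2 basePoint) =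
    Additive.ofMul (Quotient.mk _ p : π_ 2 S2 basePoint)
  refine congrArg (fun q : Ω^ (Fin 2) S2 basePoint =>
    Additive.ofMul (Quotient.mk _ q : π_ 2 S2 basePoint)) (GenLoop.ext _ _ fun u => ?_)
  exact basedAntipode_basedAntipode (p u)

/-- The `ℤ[ℤ/2]`-module `π₂(S²)`, with the action induced by the antipodal map of `S²`. -/
def pi2S2 : Rep.{0} ℤ Z2 :=
  Rep.of (involutionRep pi2Involution pi2Involution_mul_self)

end

end BredonTorus

/-!
Two computations carry the result: that of `π₂(S²)` with its involution, and that of the group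
cohomology of `ℤⁿ` with coefficients in a sign representation, to which both models of the torus
reduce.

*The cohomology of the torus.* The translations of `ℝⁿ` by the vectors `π u`, where the entries of
`u ∈ ℤⁿ` have all the same parity, form a free abelian group `Γ` of rank `n`. It acts freely on
`ℝⁿ`. The translations with even entries have the torus as quotient, and those with odd entries
induce the involution `z ↦ -z`. So the singular simplicial set of `T^n` is the quotient of the
singular simplicial set of `ℝⁿ` by the kernel of the parity `Γ → ℤ/2`. In the same way `Γ_L^n` is
the quotient of the nerve of the `n`-th power of the infinite fence, on which `Γ` acts by the
translations by `(L/2) u` (`isQuotientAlong_euclideanAct`, `isQuotientAlong_fenceAct`). Both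
coverings are acyclic, the second because the infinite fence retracts onto its finite intervals
through comparable monotone maps, so their chains are projective resolutions of the trivial
`Γ`-module `ℤ`. Equivariant cochains on the quotient are `Γ`-equivariant cochains on the covering,
and in both cases the Bredon cohomology with coefficients in `N` is `H^•(Γ; N)`, where `Γ` acts on
`N` through the parity (`IsQuotientAlong.nonempty_bredonCohomology_iso`).

In suitable coordinates of `Γ` the action on `ℤ₋` is the sign of the first coordinate. For a
character `ε` of an abelian group `G` that is trivial on the kernel of `φ : G → ℤ`, the module `ℤ`
with the action `ε` is resolved by two copies of the module coinduced from the trivial module of the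
kernel, with the operator `f ↦ t f - ε(t) f`, where `φ(t) = 1`. An element of an abelian group acts
trivially on group cohomology (`groupCohomology_map_applyAsHom`), so on cohomology the operator is
multiplication by `1 - ε(t)`, and by Shapiro's lemma the long exact sequence computes `H^•(G; ℤ)`
from `H^•(ker φ; ℤ)`. With the trivial character the multiplication is by `0`, the sequence splits
into short exact ones, and Pascal's rule gives rank `n.choose d` for `H^d(ℤⁿ; ℤ)`. With the sign the
multiplication is by `2` on a free group, so `H^d` is `H^(d-1)(ℤ^(n-1); ℤ)` modulo `2`
(`groupCohomology_sign`).

*The second homotopy group of the sphere.* Homotopies lift through the Hopf map `S³ → S²`: a lift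
of `F` is carried to one of a nowhere antipodal map `G` by projecting orthogonally to the lines over
`G` (`exists_hopf_homotopy_lift`). A spherical map, seen as a homotopy of paths, thus has a lift that
is constant on three sides of the square and winds around the fibre along the fourth, and the winding
number is its degree (`HasDegree`). The degree is additive and invariant under homotopy. If it is
zero, the lift can be unwound to a map that is constant on the boundary of the square, and such a map
to `S³` is null homotopic because it can be moved off a point (`homotopicRel_const`). An explicit lift
gives a map of degree one, so the degree is an isomorphism `π₂(S²) ≅ ℤ`. The antipodal map, followed
by the half turn, is covered by the complex conjugation of `ℂ²`, which reverses the winding: the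
involution acts on `π₂(S²)` by `-1` (`HasDegree.basedAntipode`).
-/

namespace BredonTorus

open CategoryTheory Simplicial
open scoped Topology Topology.Homotopy unitInterval

noncomputable section

/-! ### Central elements act trivially on group cohomology -/

section LinearYoneda

variable {k : Type} [CommRing k] {C : Type*} [Category.{0} C] [Abelian C]
  [Linear k C] [EnoughProjectives C]

/-- The cochain map `Hom(Q, A) ⟶ Hom(P, A)` given by composition with a chain map `P ⟶ Q`. -/
def linearYonedaMap {P Q : ChainComplex C ℕ} (φ : P ⟶ Q) (A : C) :
    Q.linearYonedaObj k A ⟶ P.linearYonedaObj k A where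
  f i := ModuleCat.ofHom (Linear.leftComp k A (φ.f i))
  comm' i j _ := ModuleCat.hom_ext <| LinearMap.ext fun (x : Q.X i ⟶ A) => by
    change P.d j i ≫ φ.f i ≫ x = φ.f j ≫ Q.d j i ≫ x
    rw [← Category.assoc, ← φ.comm, Category.assoc]

/-- The components of the homotopy that a homotopy of chain maps induces on the complexes of
morphisms to `A`. -/
def linearYonedaHomotopyHom {P Q : ChainComplex C ℕ} {φ ψ : P ⟶ Q} (h : Homotopy φ ψ) (A : C)
    (i j : ℕ) : (Q.linearYonedaObj k A).X i ⟶ (P.linearYonedaObj k A).X j :=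
  ModuleCat.ofHom (Linear.leftComp k A (h.hom j i))

/-- Homotopic chain maps induce homotopic maps on the complexes of morphisms to `A`. -/
def linearYonedaHomotopy {P Q : ChainComplex C ℕ} {φ ψ : P ⟶ Q} (h : Homotopy φ ψ) (A : C) :
    Homotopy (linearYonedaMap (k := k) φ A) (linearYonedaMap ψ A) where
  hom := linearYonedaHomotopyHom h A
  zero i j hij := ModuleCat.hom_ext <| LinearMap.ext fun (x : Q.X i ⟶ A) => by
    change h.hom j i ≫ x = 0
    rw [h.zero j i hij, Limits.zero_comp]
  comm i := ModuleCat.hom_ext <| LinearMap.ext fun (x : Q.X i ⟶ A) => by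
    have hc : φ.f i ≫ x = (dNext i h.hom + prevD i h.hom + ψ.f i) ≫ x :=
      congrArg (· ≫ x) (h.comm i)
    rw [Preadditive.add_comp, Preadditive.add_comp, add_comm (dNext i h.hom ≫ x)] at hc
    refine hc.trans (congrArg₂ (· + ·) (congrArg₂ (· + ·) ?_ ?_) rfl)
    · have e := dNext_eq (linearYonedaHomotopyHom (k := k) h A) (i := i) (i' := i + 1) rfl
      refine Eq.trans ?_ (congrArg (fun f => f.hom x) e).symm
      rw [prevD_eq (j' := i + 1) _ (by simp)]
      exact Category.assoc _ _ _
    · rcases i with _ | i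
      · have e := prevD_eq_zero (linearYonedaHomotopyHom (k := k) h A) 0 (by simp)
        refine Eq.trans ?_ (congrArg (fun f => f.hom x) e).symm
        rw [dNext_eq_zero _ _ (by simp), Limits.zero_comp]
        rfl
      · have e := prevD_eq (linearYonedaHomotopyHom (k := k) h A) (j := i + 1) (j' := i) rfl
        refine Eq.trans ?_ (congrArg (fun f => f.hom x) e).symm
        rw [dNext_eq (i := i + 1) (i' := i) _ (by simp)]
        exact Category.assoc _ _ _

end LinearYoneda

section Central

variable {k G : Type} [CommRing k] [CommGroup G]

/-- The action of `g` on each term of a complex of representations of a commutative group. -/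
def applyChainMap (P : ChainComplex (Rep.{0} k G) ℕ) (g : G) : P ⟶ P where
  f i := (P.X i).applyAsHom g
  comm' i j _ := Rep.applyAsHom_comm (P.d i j) g

theorem cochainsMap_applyAsHom (A : Rep.{0} k G) (g : G) :
    groupCohomology.cochainsMap (MonoidHom.id G) (A.applyAsHom g) =
      (groupCohomology.inhomogeneousCochainsIso A).hom ≫
        linearYonedaMap (applyChainMap (Rep.barComplex k G) g) A ≫
        (groupCohomology.inhomogeneousCochainsIso A).inv := by
  rw [← Category.assoc, Iso.eq_comp_inv]
  refine HomologicalComplex.hom_ext _ _ fun i => ModuleCat.hom_ext <| LinearMap.ext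
    fun (x : (Fin i → G) → A) => ?_
  change (Rep.freeLiftLEquiv k G (Fin i → G) A).symm (fun j => A.ρ g (x j)) =
    (Rep.free k G (Fin i → G)).applyAsHom g ≫ (Rep.freeLiftLEquiv k G (Fin i → G) A).symm x
  rw [Rep.applyAsHom_comm, LinearEquiv.symm_apply_eq]
  funext j
  have h := congrFun ((Rep.freeLiftLEquiv k G (Fin i → G) A).apply_symm_apply x) j
  exact congrArg (A.ρ g) h.symm

/-- The action of an element of a commutative group on the coefficients induces the identity in
cohomology: on `Hom(P, A)`, it agrees with the action on the resolution `P`, and this lifts the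
identity of the trivial representation. -/
theorem groupCohomology_map_applyAsHom (A : Rep.{0} k G) (g : G) (n : ℕ) :
    groupCohomology.map (MonoidHom.id G) (A.applyAsHom g) n = 𝟙 _ := by
  have hφ : applyChainMap (Rep.barComplex k G) g ≫ (Rep.barResolution k G).π =
      (Rep.barResolution k G).π := by
    refine HomologicalComplex.to_single_hom_ext ?_
    refine (Rep.applyAsHom_comm ((Rep.barResolution k G).π.f 0) g).trans ?_
    refine Rep.hom_ext (DFunLike.ext _ _ fun x => ?_)
    rfl
  have e : (Rep.barResolution k G).π = (Rep.barResolution k G).π ≫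
      (ChainComplex.single₀ _).map (𝟙 (Rep.trivial k G k)) := by
    rw [CategoryTheory.Functor.map_id, Category.comp_id]
  have h : Homotopy (applyChainMap (Rep.barComplex k G) g) (𝟙 _) :=
    ProjectiveResolution.liftHomotopy (P := Rep.barResolution k G) (Q := Rep.barResolution k G)
      (𝟙 _) _ _ (hφ.trans e) ((Category.id_comp _).trans e)
  have h' := (linearYonedaHomotopy (k := k) h A).homologyMap_eq n
  have h1 : linearYonedaMap (k := k) (𝟙 (Rep.barComplex k G)) A = 𝟙 _ := by
    refine HomologicalComplex.hom_ext _ _ fun i => ModuleCat.hom_ext <| LinearMap.ext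
      fun (x : (Rep.barComplex k G).X i ⟶ A) => ?_
    exact Category.id_comp x
  change HomologicalComplex.homologyMap _ n = _
  rw [cochainsMap_applyAsHom, HomologicalComplex.homologyMap_comp,
    HomologicalComplex.homologyMap_comp, h', h1, HomologicalComplex.homologyMap_id,
    Category.id_comp, ← HomologicalComplex.homologyMap_comp, Iso.hom_inv_id,
    HomologicalComplex.homologyMap_id]
  rfl

end Central

/-! ### The Wang sequence of an infinite cyclic quotient -/

theorem rep_exact_iff {k G : Type} [CommRing k] [Group G] (S : ShortComplex (Rep.{0} k G)) :
    S.Exact ↔ Function.Exact S.f.hom S.g.hom := by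
  rw [← ShortComplex.exact_map_iff_of_faithful S (forget₂ (Rep.{0} k G) (ModuleCat.{0} k)),
    ShortComplex.ShortExact.moduleCat_exact_iff_function_exact]
  rfl

/-- The representation of `G` on `ℤ` in which `g` acts by the sign `ε g`. -/
def signRepresentation {G : Type} [Group G] (ε : G →* ℤˣ) : Representation ℤ G ℤ where
  toFun g := ((ε g : ℤˣ) : ℤ) • LinearMap.id
  map_one' := by ext; simp
  map_mul' g h := by ext; simp

/-- The representation of `G` on `ℤ` in which `g` acts by the sign `ε g`, as an object of the
category of representations. -/
abbrev signRep {G : Type} [Group G] (ε : G →* ℤˣ) : Rep.{0} ℤ G :=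
  Rep.of (signRepresentation ε)

/-- The sum from `0` to `m`, which is minus the sum from `m` to `0` for negative `m`. -/
theorem exists_antidifference (h : ℤ → ℤ) : ∃ F : ℤ → ℤ, ∀ m, F (m + 1) - F m = h m := by
  refine ⟨fun m => ∑ i ∈ Finset.range m.toNat, h i -
    ∑ i ∈ Finset.range (-m).toNat, h (-1 - i), fun m => ?_⟩
  obtain ⟨n, rfl | rfl⟩ := m.eq_nat_or_neg
  · have h1 : ((n : ℤ) + 1).toNat = n + 1 := by omega
    have h2 : (-((n : ℤ) + 1)).toNat = 0 := by omega
    have h3 : (-(n : ℤ)).toNat = 0 := by omega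
    simp only [h1, h2, h3, Int.toNat_natCast, Finset.sum_range_succ, Finset.range_zero,
      Finset.sum_empty]
    ring
  · rcases n with _ | n
    · simp
    · have h1 : (-((n + 1 : ℕ) : ℤ) + 1).toNat = 0 := by omega
      have h2 : (-(-((n + 1 : ℕ) : ℤ) + 1)).toNat = n := by omega
      have h3 : (-((n + 1 : ℕ) : ℤ)).toNat = 0 := by omega
      have h4 : (-(-((n + 1 : ℕ) : ℤ))).toNat = n + 1 := by omega
      have h5 : -((n + 1 : ℕ) : ℤ) = -1 - n := by push_cast; ring
      simp only [h1, h2, h3, h4, Finset.sum_range_succ, Finset.range_zero, Finset.sum_empty]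
      rw [h5]
      ring

theorem exists_twisted_antidifference (e : ℤˣ) (h : ℤ → ℤ) :
    ∃ F : ℤ → ℤ, ∀ m, F (m + 1) - e * F m = h m := by
  obtain ⟨F, hF⟩ := exists_antidifference fun m => ((e ^ (-(m + 1)) : ℤˣ) : ℤ) * h m
  refine ⟨fun m => ((e ^ m : ℤˣ) : ℤ) * F m, fun m => ?_⟩
  have h1 : ((e ^ (m + 1) : ℤˣ) : ℤ) * ((e ^ (-(m + 1)) : ℤˣ) : ℤ) = 1 := by
    rw [← Units.val_mul, ← zpow_add]; simp
  have h2 : (e : ℤ) * ((e ^ m : ℤˣ) : ℤ) = ((e ^ (m + 1) : ℤˣ) : ℤ) := by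
    rw [← Units.val_mul, ← zpow_one_add, add_comm]
  linear_combination ((e ^ (m + 1) : ℤˣ) : ℤ) * hF m + h m * h1 - F m * h2

section Wang

variable {G : Type} [CommGroup G] (φ : G →* Multiplicative ℤ) (t : G) (ε : G →* ℤˣ)

/-- The representation of `G` coinduced from the trivial representation `ℤ` of the kernel of `φ`:
the functions on `G` that are invariant under the kernel. -/
abbrev kerCoind : Rep.{0} ℤ G :=
  Rep.coind φ.ker.subtype (Rep.trivial ℤ φ.ker ℤ)

/-- The embedding of `ℤ` with a sign action, trivial on the kernel of `φ`, into the coinduced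
representation: `x ↦ (g ↦ ε g * x)`. -/
def signToCoind (hε : ∀ s ∈ φ.ker, ε s = 1) : signRep ε ⟶ kerCoind φ :=
  Rep.ofHom
    { toFun x := ⟨fun g => (ε g : ℤ) * x, fun s g => by simp [hε s.1 s.2]⟩
      map_add' x y := Subtype.ext <| funext fun g => mul_add _ _ _
      map_smul' c x := Subtype.ext <| funext fun g => mul_left_comm _ _ _
      isIntertwining' g := LinearMap.ext fun (x : ℤ) => Subtype.ext <| funext fun h => by
        change (ε h : ℤ) * ((ε g : ℤ) * x) = (ε (h * g) : ℤ) * x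
        rw [map_mul, Units.val_mul, mul_assoc] }

/-- The endomorphism `f ↦ (g ↦ f (g * t) - ε t * f g)` of the coinduced representation. -/
def wangHom : kerCoind φ ⟶ kerCoind φ :=
  (kerCoind φ).applyAsHom t - (ε t : ℤ) • 𝟙 _

theorem wangHom_apply (f : kerCoind φ) (g : G) :
    ((wangHom φ t ε).hom f).1 g = f.1 (g * t) - (ε t : ℤ) * f.1 g := rfl

variable {φ t}

theorem kerCoind_apply (ht : φ t = Multiplicative.ofAdd 1) (f : kerCoind φ) (g : G) :
    f.1 g = f.1 (t ^ (φ g).toAdd) := by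
  have h : g * (t ^ (φ g).toAdd)⁻¹ ∈ φ.ker := by
    rw [MonoidHom.mem_ker, map_mul, map_inv, map_zpow, ht, ← ofAdd_zsmul]
    simp
  have := f.2 ⟨_, h⟩ (t ^ (φ g).toAdd)
  simpa using this

/-- The representation coinduced from the kernel of `φ`, resolving `ℤ` with a sign action. -/
def wangShortComplex (φ : G →* Multiplicative ℤ) (t : G) (ε : G →* ℤˣ)
    (hε : ∀ s ∈ φ.ker, ε s = 1) : ShortComplex (Rep.{0} ℤ G) :=
  ShortComplex.mk (signToCoind φ ε hε) (wangHom φ t ε) <|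
    Rep.hom_ext <| DFunLike.ext _ _ fun (x : ℤ) => Subtype.ext <| funext fun g => by
      change (ε (g * t) : ℤ) * x - (ε t : ℤ) * ((ε g : ℤ) * x) = 0
      rw [map_mul, Units.val_mul]
      ring

/-- Elements of the coinduced representation are determined by their values on the powers of `t`,
where the operator is a twisted difference: its kernel consists of the multiples of the sign, and
every sequence of integers has a twisted antidifference. -/
theorem wangShortComplex_shortExact (ht : φ t = Multiplicative.ofAdd 1)
    (hε : ∀ s ∈ φ.ker, ε s = 1) : (wangShortComplex φ t ε hε).ShortExact := by
  have hmono : Mono (signToCoind φ ε hε) := by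
    refine (Rep.mono_iff_injective _).2 fun (x y : ℤ) h => ?_
    have h1 : (ε 1 : ℤ) * x = (ε 1 : ℤ) * y := congrFun (congrArg Subtype.val h) 1
    simpa using h1
  have hepi : Epi (wangHom φ t ε) := by
    refine (Rep.epi_iff_surjective _).2 fun (y : kerCoind φ) => ?_
    obtain ⟨F, hF⟩ := exists_twisted_antidifference (ε t) fun m => y.1 (t ^ m)
    refine ⟨⟨fun g => F (φ g).toAdd, fun s g => ?_⟩, Subtype.ext <| funext fun g => ?_⟩
    · have hs : φ s.1 = 1 := s.2
      simp [hs]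
    · refine Eq.trans ?_ ((hF (φ g).toAdd).trans (kerCoind_apply ht y g).symm)
      change F (φ (g * t)).toAdd - (ε t : ℤ) * F (φ g).toAdd = _
      rw [map_mul, ht]
      rfl
  refine ShortComplex.ShortExact.mk' ?_ hmono hepi
  refine (rep_exact_iff (wangShortComplex φ t ε hε)).2 fun (f : kerCoind φ) => ?_
  change (wangHom φ t ε).hom f = 0 ↔ ∃ x : ℤ, (signToCoind φ ε hε).hom x = f
  refine ⟨fun hf => ⟨f.1 1, Subtype.ext <| funext fun g => ?_⟩, ?_⟩
  · have hD : ∀ g, f.1 (g * t) = (ε t : ℤ) * f.1 g := fun g => by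
      have := congrFun (congrArg Subtype.val hf) g
      rw [wangHom_apply] at this
      exact sub_eq_zero.1 this
    have hpow : ∀ m : ℤ, f.1 (t ^ m) = ((ε t ^ m : ℤˣ) : ℤ) * f.1 1 := by
      have hsq : (ε t : ℤ) * (ε t : ℤ) = 1 := by
        rw [← Units.val_mul, Int.units_mul_self]; rfl
      intro m
      induction m with
      | zero => simp
      | succ i ih => rw [zpow_add_one, hD, ih, zpow_add_one, Units.val_mul]; ring
      | pred i ih =>
        have h1 := hD (t ^ (-(i : ℤ) - 1))
        rw [← zpow_add_one, sub_add_cancel, ih] at h1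
        have h2 : (ε t ^ (-(i : ℤ)) : ℤˣ) = ε t ^ (-(i : ℤ) - 1) * ε t := by
          rw [← zpow_add_one, sub_add_cancel]
        rw [h2, Units.val_mul] at h1
        linear_combination ((ε t ^ (-(i : ℤ) - 1) : ℤˣ) : ℤ) * f.1 1 * hsq
          - f.1 (t ^ (-(i : ℤ) - 1)) * hsq - (ε t : ℤ) * h1
    have hεg : ε g = ε t ^ (φ g).toAdd := by
      have h : g * (t ^ (φ g).toAdd)⁻¹ ∈ φ.ker := by
        rw [MonoidHom.mem_ker, map_mul, map_inv, map_zpow, ht, ← ofAdd_zsmul]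
        simp
      have := hε _ h
      rwa [map_mul, map_inv, map_zpow, mul_inv_eq_one] at this
    change (ε g : ℤ) * f.1 1 = f.1 g
    rw [kerCoind_apply ht f g, hpow, hεg]
  · rintro ⟨x, rfl⟩
    exact DFunLike.congr_fun (congrArg Rep.Hom.hom (wangShortComplex φ t ε hε).zero) x

/-- Translation by `t` acts trivially on the cohomology, so the operator of the Wang sequence becomes
multiplication by `1 - ε t`. -/
theorem groupCohomology_map_wangHom (n : ℕ) :
    (groupCohomology.functor ℤ G n).map (wangHom φ t ε) = (1 - (ε t : ℤ)) • 𝟙 _ := by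
  change (groupCohomology.cochainsFunctor ℤ G ⋙
    HomologicalComplex.homologyFunctor (ModuleCat.{0} ℤ) _ n).map _ = _
  rw [wangHom, Functor.map_sub, Functor.map_zsmul, CategoryTheory.Functor.map_id, sub_smul,
    one_smul]
  exact congrArg (· - _) (groupCohomology_map_applyAsHom (kerCoind φ) t n)

end Wang

section Wang

variable {G : Type} [CommGroup G] {φ : G →* Multiplicative ℤ} {t : G} {ε : G →* ℤˣ}

theorem wang_exact₁ (ht : φ t = Multiplicative.ofAdd 1) (hε : ∀ s ∈ φ.ker, ε s = 1) (n : ℕ) :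
    Function.Exact
      (groupCohomology.δ (wangShortComplex_shortExact ε ht hε) n (n + 1) rfl).hom
      ((groupCohomology.functor ℤ G (n + 1)).map (signToCoind φ ε hε)).hom :=
  (ShortComplex.ShortExact.moduleCat_exact_iff_function_exact _).1
    (groupCohomology.mapShortComplex₁_exact (wangShortComplex_shortExact ε ht hε) rfl)

theorem wang_exact₂ (ht : φ t = Multiplicative.ofAdd 1) (hε : ∀ s ∈ φ.ker, ε s = 1) (n : ℕ)
    (x : groupCohomology (kerCoind φ) n) :
    (1 - (ε t : ℤ)) • x = 0 ↔
      x ∈ Set.range ((groupCohomology.functor ℤ G n).map (signToCoind φ ε hε)).hom := by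
  have h := (ShortComplex.ShortExact.moduleCat_exact_iff_function_exact _).1
    (groupCohomology.mapShortComplex₂_exact (wangShortComplex_shortExact ε ht hε) n) x
  rw [show ((groupCohomology.mapShortComplex₂ (wangShortComplex φ t ε hε) n).g) = _ from
    groupCohomology_map_wangHom ε n] at h
  exact h

theorem wang_exact₃ (ht : φ t = Multiplicative.ofAdd 1) (hε : ∀ s ∈ φ.ker, ε s = 1) (n : ℕ)
    (x : groupCohomology (kerCoind φ) n) :
    (groupCohomology.δ (wangShortComplex_shortExact ε ht hε) n (n + 1) rfl).hom x = 0 ↔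
      ∃ y, (1 - (ε t : ℤ)) • y = x := by
  have h := (ShortComplex.ShortExact.moduleCat_exact_iff_function_exact _).1
    (groupCohomology.mapShortComplex₃_exact (wangShortComplex_shortExact ε ht hε)
      (rfl : n + 1 = n + 1)) x
  rw [show ((groupCohomology.mapShortComplex₃ (wangShortComplex_shortExact ε ht hε)
    (rfl : n + 1 = n + 1)).f) = _ from groupCohomology_map_wangHom ε n] at h
  exact h

end Wang

/-! ### The cohomology of free abelian groups -/

/-- The kernel of the first coordinate of a free abelian group of rank `n + 1` is free abelian of
rank `n`. -/
def kerFirstEquiv {G : Type} [CommGroup G] {n : ℕ}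
    (e : G ≃* Multiplicative (Fin (n + 1) → ℤ)) (φ : G →* Multiplicative ℤ)
    (hφ : ∀ g, φ g = Multiplicative.ofAdd ((e g).toAdd 0)) :
    φ.ker ≃* Multiplicative (Fin n → ℤ) where
  toFun s := Multiplicative.ofAdd fun i => (e s.1).toAdd i.succ
  invFun m := ⟨e.symm (Multiplicative.ofAdd (Fin.cons 0 m.toAdd)), by
    rw [MonoidHom.mem_ker, hφ]; simp⟩
  left_inv s := by
    have h0 : (e s.1).toAdd 0 = 0 := by
      have h := s.2
      rw [MonoidHom.mem_ker, hφ] at h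
      exact h
    refine Subtype.ext ?_
    rw [MulEquiv.symm_apply_eq]
    refine Multiplicative.toAdd.injective ?_
    funext i
    refine Fin.cases ?_ (fun i => ?_) i
    · simp [h0]
    · simp
  right_inv m := by simp
  map_mul' s s' := by
    refine Multiplicative.toAdd.injective ?_
    funext i
    simp

/-- An extension of finitely generated free abelian groups splits, and the ranks add. -/
theorem exists_linearEquiv_of_exact {M N P : Type*} [AddCommGroup M] [AddCommGroup N]
    [AddCommGroup P] [Module ℤ M] [Module ℤ N] [Module ℤ P] {f : M →ₗ[ℤ] N} {g : N →ₗ[ℤ] P}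
    (h : Function.Exact f g) (hf : Function.Injective f) (hg : Function.Surjective g) {a b : ℕ}
    (hM : Nonempty (M ≃ₗ[ℤ] (Fin a → ℤ))) (hP : Nonempty (P ≃ₗ[ℤ] (Fin b → ℤ))) :
    Nonempty (N ≃ₗ[ℤ] (Fin (a + b) → ℤ)) := by
  obtain ⟨eM⟩ := hM
  obtain ⟨eP⟩ := hP
  have : Module.Projective ℤ P := Module.Projective.of_equiv eP.symm
  obtain ⟨l, hl⟩ := Module.projective_lifting_property g LinearMap.id hg
  obtain ⟨e, -⟩ := h.splitSurjectiveEquiv hf ⟨l, hl⟩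
  exact ⟨e ≪≫ₗ eM.prodCongr eP ≪≫ₗ (LinearEquiv.sumArrowLequivProdArrow _ _ ℤ ℤ).symm ≪≫ₗ
    LinearEquiv.funCongrLeft ℤ ℤ finSumFinEquiv.symm⟩

/-- The cohomology of `ℤ^n` with trivial coefficients, by induction on `n`: the Wang sequence
splits into short exact sequences. -/
theorem groupCohomology_trivial_free (n : ℕ) : ∀ (G : Type) [CommGroup G]
    (_ : G ≃* Multiplicative (Fin n → ℤ)) (d : ℕ),
    Nonempty (groupCohomology (Rep.trivial ℤ G ℤ) d ≃ₗ[ℤ] (Fin (n.choose d) → ℤ)) := by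
  induction n with
  | zero =>
    intro G _ e d
    rcases d with _ | d
    · exact ⟨(groupCohomology.H0IsoOfIsTrivial (Rep.trivial ℤ G ℤ)).toLinearEquiv ≪≫ₗ
        (LinearEquiv.funUnique (Fin 1) ℤ ℤ).symm⟩
    · have : Subsingleton G := e.toEquiv.subsingleton
      have h := isZero_groupCohomology_succ_of_subsingleton (Rep.trivial ℤ G ℤ) d
      have := ModuleCat.subsingleton_of_isZero h
      rw [Nat.choose_zero_succ]
      exact ⟨LinearEquiv.ofSubsingleton _ _⟩
  | succ n ih =>
    intro G _ e d
    rcases d with _ | d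
    · rw [Nat.choose_zero_right]
      exact ⟨(groupCohomology.H0IsoOfIsTrivial (Rep.trivial ℤ G ℤ)).toLinearEquiv ≪≫ₗ
        (LinearEquiv.funUnique (Fin 1) ℤ ℤ).symm⟩
    · let φ : G →* Multiplicative ℤ :=
        { toFun g := Multiplicative.ofAdd ((e g).toAdd 0)
          map_one' := by simp
          map_mul' g h := by simp }
      let t : G := e.symm (Multiplicative.ofAdd (Pi.single 0 1))
      have ht : φ t = Multiplicative.ofAdd 1 := by
        simp [φ, t]
      have hS : ∀ d, Nonempty (groupCohomology (kerCoind φ) d ≃ₗ[ℤ] (Fin (n.choose d) → ℤ)) := by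
        intro d
        obtain ⟨e'⟩ := ih φ.ker (kerFirstEquiv e φ fun _ => rfl) d
        exact ⟨(groupCohomology.coindIso (Rep.trivial ℤ φ.ker ℤ) d).toLinearEquiv ≪≫ₗ e'⟩
      have hε : ∀ s ∈ φ.ker, (1 : G →* ℤˣ) s = 1 := fun _ _ => rfl
      have h0 : (1 - (((1 : G →* ℤˣ) t : ℤˣ) : ℤ)) = 0 := by simp
      have key := exists_linearEquiv_of_exact (wang_exact₁ ht hε d) (by
          refine (injective_iff_map_eq_zero _).2 fun x hx => ?_
          obtain ⟨y, rfl⟩ := (wang_exact₃ ht hε d x).1 hx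
          rw [h0]
          exact zero_zsmul y)
        (fun x => (wang_exact₂ ht hε (d + 1) x).1 (by rw [h0]; exact zero_zsmul x))
        (hS d) (hS (d + 1))
      rw [Nat.choose_succ_succ]
      have htriv : signRep (1 : G →* ℤˣ) = Rep.trivial ℤ G ℤ := by
        refine congrArg (Rep.of (k := ℤ) (G := G) (X := ℤ)) (MonoidHom.ext fun g => ?_)
        ext
        simp [signRepresentation]
      rw [← htriv]
      exact key

/-- The image of `f` is killed by `2` in the free group `P`, so `f` vanishes, and `N` is the quotient of
`M` by the multiples of `2`. -/
theorem exists_addEquiv_of_exact_two {M N P : Type*} [AddCommGroup M] [AddCommGroup N]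
    [AddCommGroup P] {δ : M →+ N} {f : N →+ P} (h₁ : Function.Exact δ f)
    (h₂ : ∀ x, (2 : ℤ) • f x = 0) (h₃ : ∀ x, δ x = 0 ↔ ∃ y, (2 : ℤ) • y = x) {a b : ℕ}
    (eM : M ≃+ (Fin a → ℤ)) (eP : P ≃+ (Fin b → ℤ)) : Nonempty (N ≃+ (Fin a → ZMod 2)) := by
  have hδ : Function.Surjective δ := fun x => by
    refine (h₁ x).1 (eP.injective (funext fun i => ?_))
    have h := congrFun (congrArg eP (h₂ x)) i
    rw [map_zsmul, map_zero, Pi.smul_apply, Pi.zero_apply, smul_eq_mul] at h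
    rw [map_zero, Pi.zero_apply]
    omega
  let r : M →+ (Fin a → ZMod 2) := ((Int.castAddHom (ZMod 2)).compLeft _).comp eM.toAddMonoidHom
  have hr : Function.Surjective r := fun x =>
    ⟨eM.symm fun i => (x i).val, funext fun i => by simp [r]⟩
  have hker : δ.ker = r.ker := by
    ext x
    refine (h₃ x).trans ?_
    constructor
    · rintro ⟨y, rfl⟩
      refine funext fun i => ?_
      change ((eM ((2 : ℤ) • y) i : ℤ) : ZMod 2) = 0
      rw [map_zsmul, Pi.smul_apply, smul_eq_mul, Int.cast_mul]
      exact (congrArg (· * _) (by decide)).trans (zero_mul _)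
    · intro hx
      have hdvd : ∀ i, (2 : ℤ) ∣ eM x i := fun i =>
        (ZMod.intCast_zmod_eq_zero_iff_dvd _ 2).1 (congrFun hx i)
      choose c hc using hdvd
      refine ⟨eM.symm c, eM.injective (funext fun i => ?_)⟩
      rw [map_zsmul, AddEquiv.apply_symm_apply, hc, Pi.smul_apply, smul_eq_mul]
  exact ⟨(QuotientAddGroup.quotientKerEquivOfSurjective δ hδ).symm.trans
    ((QuotientAddGroup.quotientAddEquivOfEq hker).trans
      (QuotientAddGroup.quotientKerEquivOfSurjective r hr))⟩

/-- The cohomology of `ℤ^(n+1)` with coefficients in `ℤ`, on which the first generator acts by `-1`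
and the others trivially: in the Wang sequence the operator is multiplication by `2`. -/
theorem groupCohomology_sign (n : ℕ) (G : Type) [CommGroup G]
    (e : G ≃* Multiplicative (Fin (n + 1) → ℤ)) (ε : G →* ℤˣ)
    (hε : ∀ g, ε g = (-1) ^ ((e g).toAdd 0)) (d : ℕ) :
    Nonempty (groupCohomology (signRep ε) (d + 1) ≃+ (Fin (n.choose d) → ZMod 2)) := by
  let φ : G →* Multiplicative ℤ :=
    { toFun g := Multiplicative.ofAdd ((e g).toAdd 0)
      map_one' := by simp
      map_mul' g h := by simp }
  let t : G := e.symm (Multiplicative.ofAdd (Pi.single 0 1))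
  have ht : φ t = Multiplicative.ofAdd 1 := by
    simp [φ, t]
  have hS : ∀ d, Nonempty (groupCohomology (kerCoind φ) d ≃ₗ[ℤ] (Fin (n.choose d) → ℤ)) := by
    intro d
    obtain ⟨e'⟩ := groupCohomology_trivial_free n φ.ker (kerFirstEquiv e φ fun _ => rfl) d
    exact ⟨(groupCohomology.coindIso (Rep.trivial ℤ φ.ker ℤ) d).toLinearEquiv ≪≫ₗ e'⟩
  have hε' : ∀ s ∈ φ.ker, ε s = 1 := fun s hs => by
    have h : (e s).toAdd 0 = 0 := hs
    rw [hε, h, zpow_zero]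
  have h2 : (1 - ((ε t : ℤˣ) : ℤ)) = 2 := by
    rw [hε]
    simp [t]
  obtain ⟨eM⟩ := hS d
  obtain ⟨eM'⟩ := hS (d + 1)
  refine exists_addEquiv_of_exact_two
    (δ := (groupCohomology.δ (wangShortComplex_shortExact ε ht hε') d (d + 1) rfl).hom.toAddMonoidHom)
    (f := ((groupCohomology.functor ℤ G (d + 1)).map (signToCoind φ ε hε')).hom.toAddMonoidHom)
    (wang_exact₁ ht hε' d) (fun x => ?_) (fun x => ?_) eM.toAddEquiv eM'.toAddEquiv
  · rw [← h2]
    exact (wang_exact₂ ht hε' (d + 1) _).2 ⟨x, rfl⟩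
  · rw [← h2]
    exact wang_exact₃ ht hε' d x

/-! ### Normalized chains of a simplicial set -/

/-- The normalized chain complex with integral coefficients. -/
abbrev chains (K : SSet.{0}) : ChainComplex (ModuleCat.{0} ℤ) ℕ :=
  K.normalizedChainComplex (ModuleCat.of ℤ ℤ)

/-- The map of normalized chain complexes induced by a map of simplicial sets. -/
abbrev chainsMap {K L : SSet.{0}} (f : K ⟶ L) : chains K ⟶ chains L :=
  SSet.normalizedChainComplexMap f (ModuleCat.of ℤ ℤ)

theorem chainsMap_id (K : SSet.{0}) : chainsMap (𝟙 K) = 𝟙 _ :=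
  (SSet.normalizedChainComplexFunctorObj (ModuleCat.of ℤ ℤ)).map_id K

/-- The chain given by a simplex; it is zero if the simplex is degenerate. -/
def cell {K : SSet.{0}} {d : ℕ} (x : K _⦋d⦌) : (chains K).X d :=
  (K.ιNormalizedChainComplex (R := ModuleCat.of ℤ ℤ) x).hom (1 : ℤ)

theorem cell_eq_zero {K : SSet.{0}} {d : ℕ} {x : K _⦋d⦌} (hx : x ∈ K.degenerate d) :
    cell x = 0 := by
  rw [cell, SSet.ιNormalizedChainComplex_eq_zero K x hx]
  rfl

theorem chainsMap_cell {K L : SSet.{0}} (f : K ⟶ L) {d : ℕ} (x : K _⦋d⦌) :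
    ((chainsMap f).f d).hom (cell x) = cell (f.app _ x) :=
  LinearMap.congr_fun (congrArg ModuleCat.Hom.hom
    (SSet.ι_normalizedChainComplexMap_f (R := ModuleCat.of ℤ ℤ) f x)) (1 : ℤ)

theorem d_cell {K : SSet.{0}} {d : ℕ} (x : K _⦋d + 1⦌) :
    ((chains K).d (d + 1) d).hom (cell x) =
      ∑ i : Fin (d + 2), (-1 : ℤ) ^ (i : ℕ) • cell (K.δ i x) := by
  have h := LinearMap.congr_fun (congrArg ModuleCat.Hom.hom
    (SSet.ιNormalizedChainComplex_d (X := K) (R := ModuleCat.of ℤ ℤ) x)) (1 : ℤ)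
  refine Eq.trans h ?_
  rw [ModuleCat.hom_sum, LinearMap.sum_apply]
  rfl

theorem chains_hom_ext {K : SSet.{0}} {d : ℕ} {M : Type} [AddCommGroup M] [Module ℤ M]
    {f g : (chains K).X d →ₗ[ℤ] M} (h : ∀ x : K _⦋d⦌, f (cell x) = g (cell x)) : f = g := by
  have : ModuleCat.ofHom f = ModuleCat.ofHom g := by
    refine SSet.normalizedChainComplex_hom_ext K fun x _ => ?_
    refine ModuleCat.hom_ext (LinearMap.ext_ring ?_)
    exact h x
  exact congrArg ModuleCat.Hom.hom this

theorem exists_chains_lift {K : SSet.{0}} {d : ℕ} {M : Type} [AddCommGroup M] [Module ℤ M]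
    (φ : K _⦋d⦌ → M) (hφ : ∀ x ∈ K.degenerate d, φ x = 0) :
    ∃ f : (chains K).X d →ₗ[ℤ] M, ∀ x, f (cell x) = φ x := by
  let F : (chains K).X d ⟶ ModuleCat.of ℤ M :=
    Limits.Cofan.IsColimit.desc (K.isColimitCofanNormalizedChainComplex (ModuleCat.of ℤ ℤ) d)
      fun x => ModuleCat.ofHom (LinearMap.toSpanSingleton ℤ M (φ x.1))
  refine ⟨F.hom, fun x => ?_⟩
  by_cases hx : x ∈ K.nonDegenerate d
  · have h := Limits.Cofan.IsColimit.fac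
      (K.isColimitCofanNormalizedChainComplex (ModuleCat.of ℤ ℤ) d)
      (fun x => ModuleCat.ofHom (LinearMap.toSpanSingleton ℤ M (φ x.1))) ⟨x, hx⟩
    refine Eq.trans (LinearMap.congr_fun (congrArg ModuleCat.Hom.hom h) (1 : ℤ)) ?_
    exact LinearMap.toSpanSingleton_apply_one ℤ M (φ x)
  · rw [← SSet.mem_degenerate_iff_notMem_nonDegenerate] at hx
    rw [cell_eq_zero hx, map_zero, hφ x hx]

theorem chains_addMonoidHom_ext {K : SSet.{0}} {d : ℕ} {M : Type} [AddCommGroup M]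
    {f g : (chains K).X d →+ M} (h : ∀ x : K _⦋d⦌, f (cell x) = g (cell x)) : f = g := by
  have key (f : (chains K).X d →+ M) : ∃ F : (chains K).X d →ₗ[ℤ] M, ∀ x, F x = f x :=
    ⟨{ toFun := f, map_add' := map_add f, map_smul' := fun c x =>
      (congrArg f (int_smul_eq_zsmul ((chains K).X d).isModule c x)).trans (map_zsmul f c x) },
      fun _ => rfl⟩
  obtain ⟨F, hF⟩ := key f
  obtain ⟨F', hF'⟩ := key g
  have : F = F' := chains_hom_ext fun x => by rw [hF, hF', h]
  exact AddMonoidHom.ext fun x => by rw [← hF, ← hF', this]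

theorem mem_of_forall_cell_mem {K : SSet.{0}} {d : ℕ} (S : AddSubgroup ((chains K).X d))
    (h : ∀ x : K _⦋d⦌, cell x ∈ S) (z : (chains K).X d) : z ∈ S := by
  have : QuotientAddGroup.mk' S = 0 :=
    chains_addMonoidHom_ext fun x => (QuotientAddGroup.eq_zero_iff _).2 (h x)
  exact (QuotientAddGroup.eq_zero_iff _).1 (DFunLike.congr_fun this z)

/-- The augmentation of the chains of degree zero: the sum of the coefficients. -/
def augmentation (K : SSet.{0}) : (chains K).X 0 →ₗ[ℤ] ℤ :=
  (exists_chains_lift (fun _ : K _⦋0⦌ => (1 : ℤ)) (by simp)).choose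

theorem augmentation_cell {K : SSet.{0}} (x : K _⦋0⦌) : augmentation K (cell x) = 1 :=
  (exists_chains_lift (fun _ : K _⦋0⦌ => (1 : ℤ)) (by simp)).choose_spec x

theorem augmentation_d (K : SSet.{0}) (z : (chains K).X 1) :
    augmentation K (((chains K).d 1 0).hom z) = 0 := by
  have : augmentation K ∘ₗ ((chains K).d 1 0).hom = 0 := chains_hom_ext fun x => by
    rw [LinearMap.comp_apply, d_cell, map_sum, Fin.sum_univ_two, map_zsmul, map_zsmul,
      augmentation_cell, augmentation_cell]
    simp
  exact LinearMap.congr_fun this z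

/-- A homotopy of maps of simplicial sets induces a homotopy of maps of normalized chains. -/
def chainsHomotopy {K L : SSet.{0}} {f g : K ⟶ L} (H : SSet.Homotopy f g) :
    Homotopy (chainsMap f) (chainsMap g) :=
  ((H.chainComplexMap (ModuleCat.of ℤ ℤ)).compRight _).compLeft _

/-- A simplicial set is acyclic if its augmented normalized chain complex is exact. -/
structure IsAcyclic (K : SSet.{0}) : Prop where
  nonempty : Nonempty (K _⦋0⦌)
  exact_succ : ∀ d, Function.Exact ((chains K).d (d + 2) (d + 1)).hom ((chains K).d (d + 1) d).hom
  exact_zero : Function.Exact ((chains K).d 1 0).hom (augmentation K)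

theorem homotopy_apply {K L : SSet.{0}} {φ ψ : chains K ⟶ chains L} (H : Homotopy φ ψ) (d : ℕ)
    (z : (chains K).X d) (hz : ∀ j, ((chains K).d d j).hom z = 0) :
    ∃ b, (φ.f d).hom z = ((chains L).d (d + 1) d).hom b + (ψ.f d).hom z := by
  refine ⟨(H.hom d (d + 1)).hom z, ?_⟩
  have h := LinearMap.congr_fun (congrArg ModuleCat.Hom.hom (H.comm d)) z
  refine h.trans ?_
  rw [ModuleCat.hom_add, ModuleCat.hom_add, LinearMap.add_apply, LinearMap.add_apply]
  congr 1
  have h1 : (dNext d H.hom).hom z = 0 := by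
    rcases d with _ | d
    · rw [dNext_eq_zero _ _ (by simp)]; rfl
    · rw [dNext_eq (i := d + 1) (i' := d) _ (by simp)]
      change (H.hom d (d + 1)).hom (((chains K).d (d + 1) d).hom z) = 0
      rw [hz, map_zero]
  have h2 : (prevD d H.hom).hom z = ((chains L).d (d + 1) d).hom ((H.hom d (d + 1)).hom z) := by
    rw [prevD_eq (j := d) (j' := d + 1) _ (by simp)]
    rfl
  rw [h1, h2, zero_add]

/-- A simplicial set is acyclic if every chain is fixed by a map that is homotopic, on chains, to
the constant map at a vertex `v`. -/
theorem isAcyclic_of_homotopy {K : SSet.{0}} (v : K _⦋0⦌) (c : K ⟶ K)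
    (hc : ∀ x : K _⦋0⦌, c.app _ x = v) (hc' : ∀ d (x : K _⦋d + 1⦌), c.app _ x ∈ K.degenerate (d + 1))
    (h : ∀ d (z : (chains K).X d), ∃ f : K ⟶ K, ((chainsMap f).f d).hom z = z ∧
      Nonempty (Homotopy (chainsMap f) (chainsMap c))) : IsAcyclic K := by
  refine ⟨⟨v⟩, fun d z => ⟨fun hz => ?_, ?_⟩, fun z => ⟨fun hz => ?_, ?_⟩⟩
  · obtain ⟨f, hf, ⟨H⟩⟩ := h (d + 1) z
    obtain ⟨b, hb⟩ := homotopy_apply H (d + 1) z fun j => by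
      by_cases hj : j = d
      · rw [hj, hz]
      · rw [(chains K).shape _ _ (fun h => hj (Nat.succ_injective h))]; rfl
    refine ⟨b, ?_⟩
    have h0 : ((chainsMap c).f (d + 1)).hom = 0 := chains_hom_ext fun x => by
      rw [chainsMap_cell, cell_eq_zero (hc' d x)]; rfl
    have e : ((chainsMap c).f (d + 1)).hom z = 0 := LinearMap.congr_fun h0 z
    rw [e, add_zero, hf] at hb
    exact hb.symm
  · rintro ⟨b, hb⟩
    rw [← hb, ← ModuleCat.comp_apply, (chains K).d_comp_d]
    rfl
  · obtain ⟨f, hf, ⟨H⟩⟩ := h 0 z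
    obtain ⟨b, hb⟩ := homotopy_apply H 0 z fun j => by
      rw [(chains K).shape _ _ (by simp)]; rfl
    refine ⟨b, ?_⟩
    have h0 : ((chainsMap c).f 0).hom = LinearMap.toSpanSingleton ℤ _ (cell v) ∘ₗ augmentation K :=
      chains_hom_ext fun x => by
        rw [chainsMap_cell, hc, LinearMap.comp_apply, augmentation_cell,
          LinearMap.toSpanSingleton_apply_one]
    have e : ((chainsMap c).f 0).hom z = 0 := by
      refine (LinearMap.congr_fun h0 z).trans ?_
      rw [LinearMap.comp_apply, hz, map_zero]
    rw [e, add_zero, hf] at hb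
    exact hb.symm
  · rintro ⟨b, hb⟩
    rw [← hb]
    exact augmentation_d K b

/-! ### Free actions on acyclic simplicial sets -/

/-- A map of representations over `ℤ` from an additive map that commutes with the actions. The module
structure over `ℤ` that is part of a representation need not be definitionally the one of the
underlying abelian group, so its compatibility with the map is proved. -/
def repHomOfAddMonoidHom {G : Type} [Group G] {A B : Rep.{0} ℤ G} (f : A →+ B)
    (hf : ∀ g x, f (A.ρ g x) = B.ρ g (f x)) : A ⟶ B :=
  have key {k : Type} [CommRing k] {A B : Rep.{0} k G} (f : A →+ B)
    (hs : ∀ (c : k) x, f (c • x) = c • f x)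
    (hf : ∀ g x, f (A.ρ g x) = B.ρ g (f x)) : A ⟶ B :=
      Rep.ofHom ⟨{ f with map_smul' := hs }, fun g => LinearMap.ext fun x => hf g x⟩
  key f (fun c x => by
    refine (congrArg f (int_smul_eq_zsmul A.hV2 c x)).trans ?_
    exact (map_zsmul f c x).trans (int_smul_eq_zsmul B.hV2 c (f x)).symm) hf

section Action

variable {G : Type} [Group G] {K : SSet.{0}} (act : G →* End K)

theorem act_mul_apply (g h : G) {d : ℕ} (x : K _⦋d⦌) :
    (act (g * h)).app _ x = (act g).app _ ((act h).app _ x) := by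
  rw [map_mul]; rfl

theorem act_one_apply {d : ℕ} (x : K _⦋d⦌) : (act 1).app _ x = x := by
  rw [map_one]; rfl

/-- The representation of a group on the normalized chains of a simplicial set on which it acts. -/
def chainsRepresentation (d : ℕ) : Representation ℤ G ((chains K).X d) where
  toFun g := ((chainsMap (act g)).f d).hom
  map_one' := chains_hom_ext fun x => by
    rw [chainsMap_cell, act_one_apply]; rfl
  map_mul' g h := chains_hom_ext fun x => by
    rw [chainsMap_cell, act_mul_apply, ← chainsMap_cell, ← chainsMap_cell]; rfl

theorem chainsRepresentation_cell {d : ℕ} (g : G) (x : K _⦋d⦌) :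
    chainsRepresentation act d g (cell x) = cell ((act g).app _ x) :=
  chainsMap_cell (act g) x

/-- The normalized chains of a simplicial set with an action of `G`, as a complex of
representations of `G`. -/
def chainsRep : ChainComplex (Rep.{0} ℤ G) ℕ where
  X d := Rep.of (chainsRepresentation act d)
  d i j := Rep.ofHom
    { toLinearMap := ((chains K).d i j).hom
      isIntertwining' := fun g => congrArg ModuleCat.Hom.hom ((chainsMap (act g)).comm i j) }
  shape i j hij := by
    refine Rep.hom_ext (DFunLike.ext _ _ fun x => ?_)
    exact LinearMap.congr_fun (congrArg ModuleCat.Hom.hom ((chains K).shape i j hij)) x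
  d_comp_d' i j k _ _ := by
    refine Rep.hom_ext (DFunLike.ext _ _ fun x => ?_)
    exact LinearMap.congr_fun (congrArg ModuleCat.Hom.hom ((chains K).d_comp_d i j k)) x

/-- The chain given by a simplex, as an element of the representation on the chains. -/
def cellRep {d : ℕ} (x : K _⦋d⦌) : (chainsRep act).X d := cell x

theorem cellRep_eq_zero {d : ℕ} {x : K _⦋d⦌} (hx : x ∈ K.degenerate d) : cellRep act x = 0 :=
  cell_eq_zero hx

theorem ρ_cellRep {d : ℕ} (g : G) (x : K _⦋d⦌) :
    ((chainsRep act).X d).ρ g (cellRep act x) = cellRep act ((act g).app _ x) :=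
  chainsMap_cell (act g) x

theorem chainsRep_hom_ext {d : ℕ} {M : Rep.{0} ℤ G} {f g : (chainsRep act).X d ⟶ M}
    (h : ∀ x : K _⦋d⦌, f.hom (cellRep act x) = g.hom (cellRep act x)) : f = g := by
  refine Rep.hom_ext (DFunLike.ext _ _ fun z => ?_)
  exact DFunLike.congr_fun (chains_addMonoidHom_ext (K := K) (d := d) (M := M)
    (f := AddMonoidHom.mk' (fun z => f.hom z) (map_add f.hom))
    (g := AddMonoidHom.mk' (fun z => g.hom z) (map_add g.hom)) h) z

theorem exists_chainsRep_lift {d : ℕ} {M : Rep.{0} ℤ G} (φ : K _⦋d⦌ → M)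
    (hφ : ∀ x ∈ K.degenerate d, φ x = 0) (hφ' : ∀ g x, φ ((act g).app _ x) = M.ρ g (φ x)) :
    ∃ f : (chainsRep act).X d ⟶ M, ∀ x : K _⦋d⦌, f.hom (cellRep act x) = φ x := by
  obtain ⟨f, hf⟩ := exists_chains_lift φ hφ
  refine ⟨repHomOfAddMonoidHom (A := (chainsRep act).X d) f.toAddMonoidHom fun g => ?_, hf⟩
  refine DFunLike.congr_fun (chains_addMonoidHom_ext
    (f := f.toAddMonoidHom.comp (chainsRepresentation act d g).toAddMonoidHom)
    (g := (M.ρ g : M →+ M).comp f.toAddMonoidHom) fun x => ?_)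
  change f (chainsRepresentation act d g (cell x)) = M.ρ g (f (cell x))
  rw [chainsRepresentation_cell, hf, hf, hφ']

variable {act} in
/-- If the action is free on simplices, the chains are projective: a map to a quotient is lifted on
representatives of the orbits of nondegenerate simplices. -/
theorem projective_chainsRep (hfree : ∀ d (x : K _⦋d⦌) g, (act g).app _ x = x → g = 1) (d : ℕ) :
    Projective ((chainsRep act).X d) where
  factors {E X} f e he := by
    classical
    let s : Setoid (K _⦋d⦌) :=
      { r := fun x y => ∃ g, (act g).app _ x = y
        iseqv :=
          ⟨fun x => ⟨1, act_one_apply act x⟩, fun {x y} ⟨g, hg⟩ => ⟨g⁻¹, by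
            rw [← hg, ← act_mul_apply, inv_mul_cancel, act_one_apply]⟩,
            fun {x y z} ⟨g, hg⟩ ⟨h, hh⟩ => ⟨h * g, by rw [act_mul_apply, hg, hh]⟩⟩ }
    -- `r x` represents the orbit of `x`, and `γ x` is the element that carries `r x` to `x`; it is
    -- unique, hence equivariant in `x`, because the action is free
    let r : K _⦋d⦌ → K _⦋d⦌ := fun x => (Quotient.mk s x).out
    have hr : ∀ x, ∃ g, (act g).app _ (r x) = x := fun x => Quotient.mk_out (s := s) x
    choose γ hγ using hr
    have hrg : ∀ g x, r ((act g).app _ x) = r x := fun g x =>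
      congrArg Quotient.out (Quotient.sound (s := s) ⟨g⁻¹, by
        rw [← act_mul_apply, inv_mul_cancel, act_one_apply]⟩)
    have hγg : ∀ g x, γ ((act g).app _ x) = g * γ x := fun g x => by
      have h1 : (act (γ ((act g).app _ x))).app _ (r x) = (act (g * γ x)).app _ (r x) := by
        rw [act_mul_apply, hγ x]
        nth_rw 1 [← hrg g x]
        exact hγ _
      have h2 := hfree d (r x) ((g * γ x)⁻¹ * γ ((act g).app _ x)) (by
        rw [act_mul_apply, h1, ← act_mul_apply, inv_mul_cancel, act_one_apply])
      rw [inv_mul_eq_one] at h2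
      exact h2.symm
    have hsurj := (Rep.epi_iff_surjective e).1 he
    choose y hy using fun x : K _⦋d⦌ => hsurj (f.hom (cellRep act (r x)))
    have hdeg : ∀ g (x : K _⦋d⦌), (act g).app _ x ∈ K.degenerate d ↔ x ∈ K.degenerate d := by
      refine fun g x => ⟨fun h => ?_, fun h => SSet.degenerate_app_apply h _⟩
      have := SSet.degenerate_app_apply h (act g⁻¹)
      rwa [← act_mul_apply, inv_mul_cancel, act_one_apply] at this
    let y' : K _⦋d⦌ → E := fun x => y (r x)
    obtain ⟨F, hF⟩ := exists_chainsRep_lift act (M := E)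
      (fun x => if x ∈ K.degenerate d then 0 else E.ρ (γ x) (y' x))
      (fun x hx => if_pos hx) (fun g x => by
        by_cases hx : x ∈ K.degenerate d
        · simp only [hdeg, hx, if_true, map_zero]
        · simp only [hdeg, hx, if_false, hγg, y', hrg]
          rw [map_mul]; rfl)
    refine ⟨F, chainsRep_hom_ext act fun x => ?_⟩
    refine (congrArg e.hom (hF x)).trans ?_
    split_ifs with hx
    · rw [cellRep_eq_zero act hx, map_zero, map_zero]
    · have hrr : r (r x) = r x := by
        have h := hrg (γ x) (r x)
        rw [hγ x] at h
        exact h.symm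
      refine (Rep.hom_comm_apply e (γ x) (y (r x))).trans ?_
      rw [hy, hrr]
      refine (Rep.hom_comm_apply f (γ x) (cellRep act (r x))).symm.trans ?_
      rw [ρ_cellRep, hγ x]

/-- The augmentation as a map to the trivial representation. -/
def augmentationRep : (chainsRep act).X 0 ⟶ Rep.trivial ℤ G ℤ :=
  Rep.ofHom ⟨augmentation K, fun g => chains_hom_ext fun x => by
    rw [LinearMap.comp_apply, chainsRepresentation_cell, augmentation_cell, LinearMap.comp_apply,
      augmentation_cell]
    rfl⟩

theorem d_comp_augmentationRep : (chainsRep act).d 1 0 ≫ augmentationRep act = 0 :=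
  Rep.hom_ext (DFunLike.ext _ _ fun z => augmentation_d K z)

/-- The augmentation as a map of complexes. -/
def augmentationChainMap :
    chainsRep act ⟶ (ChainComplex.single₀ _).obj (Rep.trivial ℤ G ℤ) :=
  ((chainsRep act).toSingle₀Equiv _).symm ⟨augmentationRep act, d_comp_augmentationRep act⟩

theorem quasiIso_augmentation (hK : IsAcyclic K) : QuasiIso (augmentationChainMap act) where
  quasiIsoAt d := by
    rcases d with _ | d
    · rw [ChainComplex.quasiIsoAt₀_iff, ShortComplex.quasiIso_iff_of_zeros' _ (by simp; rfl) rfl rfl]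
      have h0 : (augmentationChainMap act).f 0 = augmentationRep act :=
        ChainComplex.toSingle₀Equiv_symm_apply_f_zero _ _
      constructor
      · rw [rep_exact_iff]
        have key : ∀ φ : (chainsRep act).X 0 ⟶ Rep.trivial ℤ G ℤ, φ = augmentationRep act →
            Function.Exact ((chainsRep act).d 1 0).hom φ.hom := by
          rintro _ rfl
          exact hK.exact_zero
        exact key _ h0
      · have key : ∀ φ : (chainsRep act).X 0 ⟶ Rep.trivial ℤ G ℤ, φ = augmentationRep act →
            Epi φ := by
          rintro _ rfl
          rw [Rep.epi_iff_surjective]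
          intro m
          obtain ⟨v⟩ := hK.nonempty
          refine ⟨m • cellRep act v, ?_⟩
          refine (map_zsmul (augmentation K) m (cell v)).trans ?_
          rw [augmentation_cell]
          exact mul_one m
        exact key _ h0
    · rw [quasiIsoAt_iff_exactAt' _ _ (ChainComplex.exactAt_succ_single_obj _ _),
        HomologicalComplex.exactAt_iff' _ (d + 2) (d + 1) d (by simp) (by simp), rep_exact_iff]
      exact hK.exact_succ d

/-- The chains of an acyclic simplicial set on which `G` acts freely resolve the trivial
representation. -/
def chainsResolution (hfree : ∀ d (x : K _⦋d⦌) g, (act g).app _ x = x → g = 1)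
    (hK : IsAcyclic K) : ProjectiveResolution (Rep.trivial ℤ G ℤ) where
  complex := chainsRep act
  projective := projective_chainsRep hfree
  π := augmentationChainMap act
  quasiIso := quasiIso_augmentation act hK

end Action

/-! ### Bredon cohomology from an acyclic covering -/

namespace Z2SSet

/-- The map of simplicial sets by which an element of `Z2` acts. -/
def act (X : Z2SSet) (g : Z2) : X.K ⟶ X.K := if g = nu then X.ν else 𝟙 X.K

theorem act_one (X : Z2SSet) : X.act 1 = 𝟙 X.K := if_neg (by decide)

theorem act_nu (X : Z2SSet) : X.act nu = X.ν := if_pos rfl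

/-- The chain given by a simplex, as an element of the module of equivariant chains. -/
def equivariantCell (X : Z2SSet) {d : ℕ} (x : X.K _⦋d⦌) : X.equivariantChains.X d := cell x

theorem ρ_equivariantChains (X : Z2SSet) {d : ℕ} (g : Z2) (z : X.equivariantChains.X d) :
    (X.equivariantChains.X d).ρ g z = ((chainsMap (X.act g)).f d).hom z := by
  rcases Z2.eq_one_or_nu g with rfl | rfl
  · rw [map_one, act_one, chainsMap_id]
    rfl
  · rw [act_nu]
    exact LinearMap.congr_fun (involutionRep_nu (X.chainInvolution.f d).hom
      (X.chainInvolution_mul_self d)) z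

theorem ρ_equivariantCell (X : Z2SSet) {d : ℕ} (g : Z2) (x : X.K _⦋d⦌) :
    (X.equivariantChains.X d).ρ g (X.equivariantCell x) =
      X.equivariantCell ((X.act g).app _ x) :=
  (ρ_equivariantChains X g (X.equivariantCell x)).trans (chainsMap_cell (X.act g) x)

theorem equivariantChains_hom_ext (X : Z2SSet) {d : ℕ} {N : Rep.{0} ℤ Z2}
    {f g : X.equivariantChains.X d ⟶ N}
    (h : ∀ x : X.K _⦋d⦌, f.hom (X.equivariantCell x) = g.hom (X.equivariantCell x)) : f = g := by
  refine Rep.hom_ext (DFunLike.ext _ _ fun z => ?_)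
  exact DFunLike.congr_fun (chains_addMonoidHom_ext (K := X.K) (d := d) (M := N)
    (f := AddMonoidHom.mk' (fun z => f.hom z) (map_add f.hom))
    (g := AddMonoidHom.mk' (fun z => g.hom z) (map_add g.hom)) h) z

theorem exists_equivariantChains_lift (X : Z2SSet) {d : ℕ} {N : Rep.{0} ℤ Z2} (φ : X.K _⦋d⦌ → N)
    (hφ : ∀ x ∈ X.K.degenerate d, φ x = 0)
    (hφ' : ∀ g x, φ ((X.act g).app _ x) = N.ρ g (φ x)) :
    ∃ f : X.equivariantChains.X d ⟶ N, ∀ x, f.hom (X.equivariantCell x) = φ x := by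
  obtain ⟨f, hf⟩ := exists_chains_lift φ hφ
  refine ⟨repHomOfAddMonoidHom (A := X.equivariantChains.X d) f.toAddMonoidHom fun g => ?_, hf⟩
  refine DFunLike.congr_fun (chains_addMonoidHom_ext
    (f := f.toAddMonoidHom.comp (AddMonoidHom.mk' (fun z => (X.equivariantChains.X d).ρ g z)
      (map_add ((X.equivariantChains.X d).ρ g))))
    (g := (N.ρ g : N →+ N).comp f.toAddMonoidHom) fun x => ?_)
  change f ((X.equivariantChains.X d).ρ g (X.equivariantCell x)) = N.ρ g (f (cell x))
  rw [ρ_equivariantCell]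
  exact (hf _).trans ((hφ' g x).trans (congrArg (N.ρ g) (hf x).symm))

end Z2SSet

/-- A map `p` of a simplicial set with an action of `G` onto a simplicial set `X` with an action of
`ℤ/2` that is equivariant along `χ : G → ℤ/2` and exhibits `X` as the quotient of the source by the
kernel of `χ`. -/
structure IsQuotientAlong {G : Type} [Group G] {K : SSet.{0}} (act : G →* End K) (χ : G →* Z2)
    (X : Z2SSet) (p : K ⟶ X.K) : Prop where
  surjective : Function.Surjective χ
  comm : ∀ (g : G) (d : ℕ) (x : K _⦋d⦌), p.app _ ((act g).app _ x) = (X.act (χ g)).app _ (p.app _ x)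
  lift : ∀ (d : ℕ) (y : X.K _⦋d⦌), ∃ x : K _⦋d⦌, p.app _ x = y
  fibre : ∀ (d : ℕ) (x y : K _⦋d⦌), p.app _ x = p.app _ y → ∃ g, χ g = 1 ∧ (act g).app _ x = y

/-- The complex of morphisms to `A`, with the module structures that come from those of `A`. -/
def homComplex {k G : Type} [CommRing k] [Group G] (P : ChainComplex (Rep.{0} k G) ℕ)
    (A : Rep.{0} k G) : CochainComplex (ModuleCat.{0} k) ℕ :=
  P.linearYonedaObj k A

/-- An additive map is a map of modules over `ℤ`. -/
def intModuleHom {A B : ModuleCat.{0} ℤ} (f : A →+ B) : A ⟶ B :=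
  ModuleCat.ofHom
    { toFun := f
      map_add' := map_add f
      map_smul' := fun m a => (congrArg f (int_smul_eq_zsmul A.isModule m a)).trans
        ((map_zsmul f m a).trans (int_smul_eq_zsmul B.isModule m (f a)).symm) }

namespace IsQuotientAlong

variable {G : Type} [Group G] {K : SSet.{0}} {act : G →* End K} {χ : G →* Z2}
  {X : Z2SSet} {p : K ⟶ X.K}

theorem mem_degenerate (h : IsQuotientAlong act χ X p) {d : ℕ} {x : K _⦋d⦌}
    (hx : p.app _ x ∈ X.K.degenerate d) : x ∈ K.degenerate d := by
  rw [SSet.mem_degenerate_iff] at hx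
  obtain ⟨m, hm, f, hf, y, hy⟩ := hx
  obtain ⟨z, rfl⟩ := h.lift m y
  obtain ⟨g, -, hg⟩ := h.fibre d (K.map f.op z) x
    ((NatTrans.naturality_apply p f.op z).trans hy)
  rw [← hg]
  refine SSet.degenerate_app_apply ?_ _
  rw [SSet.mem_degenerate_iff]
  exact ⟨m, hm, f, hf, z, rfl⟩

variable (act χ X p) in
/-- The chains of the covering map to those of the quotient. -/
def chainsHom (h : IsQuotientAlong act χ X p) (d : ℕ) :
    (chainsRep act).X d ⟶ Rep.res χ (X.equivariantChains.X d) :=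
  repHomOfAddMonoidHom (((chainsMap p).f d).hom.toAddMonoidHom) fun g z => by
    refine Eq.trans ?_ (Z2SSet.ρ_equivariantChains X (χ g) _).symm
    refine DFunLike.congr_fun (chains_addMonoidHom_ext
      (f := ((chainsMap p).f d).hom.toAddMonoidHom.comp
        (chainsRepresentation act d g).toAddMonoidHom)
      (g := ((chainsMap (X.act (χ g))).f d).hom.toAddMonoidHom.comp
        ((chainsMap p).f d).hom.toAddMonoidHom) fun x => ?_) z
    change ((chainsMap p).f d).hom (chainsRepresentation act d g (cell x)) =
      ((chainsMap (X.act (χ g))).f d).hom (((chainsMap p).f d).hom (cell x))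
    rw [chainsRepresentation_cell, chainsMap_cell, chainsMap_cell, chainsMap_cell, h.comm]

/-- Equivariant cochains of the quotient, pulled back to the covering. -/
def pullback (h : IsQuotientAlong act χ X p) (N : Rep.{0} ℤ Z2) :
    X.equivariantCochains N ⟶ homComplex (chainsRep act) (Rep.res χ N) where
  f d := intModuleHom (A := (X.equivariantCochains N).X d)
    (B := (homComplex (chainsRep act) (Rep.res χ N)).X d)
    { toFun := fun (c : X.equivariantChains.X d ⟶ N) =>
        chainsHom act χ X p h d ≫ (Rep.resFunctor χ).map c
      map_zero' := rfl
      map_add' := fun c c' => rfl }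
  comm' i j _ := ModuleCat.hom_ext <| LinearMap.ext fun (c : X.equivariantChains.X i ⟶ N) => by
    refine Rep.hom_ext (DFunLike.ext _ _ fun z => ?_)
    change c.hom (((chainsMap p).f i).hom (((chains K).d j i).hom z)) =
      c.hom (((chains X.K).d j i).hom (((chainsMap p).f j).hom z))
    refine congrArg c.hom ?_
    exact (LinearMap.congr_fun (congrArg ModuleCat.Hom.hom ((chainsMap p).comm j i)) z).symm

theorem pullback_cellRep (h : IsQuotientAlong act χ X p) (N : Rep.{0} ℤ Z2) {d : ℕ}
    (c : X.equivariantChains.X d ⟶ N) (x : K _⦋d⦌) :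
    Rep.Hom.hom (A := (chainsRep act).X d) (B := Rep.res χ N)
      (((h.pullback N).f d).hom c) (cellRep act x) = c.hom (X.equivariantCell (p.app _ x)) :=
  congrArg c.hom (chainsMap_cell p x)

/-- An equivariant cochain of the covering descends to the quotient, since it takes related values
on the simplices of an orbit. -/
theorem bijective_pullback (h : IsQuotientAlong act χ X p) (N : Rep.{0} ℤ Z2) (d : ℕ) :
    Function.Bijective ((h.pullback N).f d).hom := by
  constructor
  · intro (c : X.equivariantChains.X d ⟶ N) (c' : X.equivariantChains.X d ⟶ N) hcc
    refine X.equivariantChains_hom_ext fun y => ?_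
    obtain ⟨x, rfl⟩ := h.lift d y
    rw [← h.pullback_cellRep, ← h.pullback_cellRep, hcc]
  · intro (c : (chainsRep act).X d ⟶ Rep.res χ N)
    choose s hs using h.lift d
    have key : ∀ g x y, p.app _ x = (X.act (χ g)).app _ (p.app _ y) →
        c.hom (cellRep act x) = N.ρ (χ g) (c.hom (cellRep act y)) := by
      intro g x y hxy
      rw [← h.comm] at hxy
      obtain ⟨g', hg', hx⟩ := h.fibre d _ _ hxy.symm
      rw [← hx, ← ρ_cellRep, ← ρ_cellRep]
      refine (Rep.hom_comm_apply c g' _).trans ?_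
      refine (congrArg (fun q => N.ρ q _) hg').trans ?_
      refine (DFunLike.congr_fun (map_one N.ρ) _).trans ?_
      exact Rep.hom_comm_apply c g _
    obtain ⟨f, hf⟩ := X.exists_equivariantChains_lift (N := N)
      (fun y => c.hom (cellRep act (s y)))
      (fun y hy => by
        rw [cellRep_eq_zero act (h.mem_degenerate (by rwa [hs])), map_zero])
      (fun g y => by
        obtain ⟨g, rfl⟩ := h.surjective g
        refine key g _ _ ?_
        rw [hs, hs])
    refine ⟨f, ?_⟩
    refine chainsRep_hom_ext act (M := Rep.res χ N) fun x => ?_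
    refine (h.pullback_cellRep N f x).trans ?_
    rw [hf]
    refine (key 1 _ x ?_).trans ?_
    · rw [hs, map_one, X.act_one]; rfl
    · rw [map_one, map_one]; rfl

/-- The Bredon cohomology of the quotient of an acyclic simplicial set by a free action is group
cohomology. -/
theorem nonempty_bredonCohomology_iso (h : IsQuotientAlong act χ X p) (hK : IsAcyclic K)
    (hfree : ∀ d (x : K _⦋d⦌) g, (act g).app _ x = x → g = 1) (N : Rep.{0} ℤ Z2) (d : ℕ) :
    Nonempty (X.bredonCohomology N d ≅ groupCohomology (Rep.res χ N) d) := by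
  have : ∀ d, IsIso ((h.pullback N).f d) := fun d =>
    (ConcreteCategory.isIso_iff_bijective _).2 (h.bijective_pullback N d)
  have : IsIso (h.pullback N) := HomologicalComplex.Hom.isIso_of_components _
  exact ⟨(HomologicalComplex.homologyFunctor _ _ d).mapIso (asIso (h.pullback N)) ≪≫
    (groupCohomologyIso (Rep.res χ N) d (chainsResolution act hfree hK)).symm⟩

end IsQuotientAlong

/-! ### The lattice acting on the universal covering of the torus -/

/-- The group of deck transformations, of rank `n + 1`. -/
abbrev Lattice (n : ℕ) : Type := Multiplicative (Fin (n + 1) → ℤ)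

/-- The parity of the first coordinate. -/
def parity (n : ℕ) : Lattice n →* Z2 :=
  AddMonoidHom.toMultiplicative ((Int.castAddHom (ZMod 2)).comp (Pi.evalAddMonoidHom _ 0))

theorem parity_surjective (n : ℕ) : Function.Surjective (parity n) := fun z => by
  obtain ⟨m, hm⟩ := ZMod.intCast_surjective z.toAdd
  exact ⟨Multiplicative.ofAdd fun _ => m, hm⟩

theorem parity_eq_one_iff {n : ℕ} (g : Lattice n) : parity n g = 1 ↔ Even (g.toAdd 0) :=
  ZMod.intCast_eq_zero_iff_even

theorem parity_eq_nu_iff {n : ℕ} (g : Lattice n) : parity n g = nu ↔ Odd (g.toAdd 0) := by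
  rw [← Int.not_even_iff_odd, ← parity_eq_one_iff]
  rcases Z2.eq_one_or_nu (parity n g) with h | h <;> rw [h] <;> decide

/-- The multiples of the half period by which a lattice element translates the coordinates: these
are the vectors whose entries have all the same parity. -/
def weight {n : ℕ} (g : Lattice n) (i : Fin (n + 1)) : ℤ :=
  if i = 0 then g.toAdd 0 else g.toAdd 0 + 2 * g.toAdd i

theorem weight_one {n : ℕ} (i : Fin (n + 1)) : weight (1 : Lattice n) i = 0 := by
  simp [weight]

theorem weight_mul {n : ℕ} (g h : Lattice n) (i : Fin (n + 1)) :
    weight (g * h) i = weight g i + weight h i := by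
  rw [weight, weight, weight, toAdd_mul, Pi.add_apply, Pi.add_apply]
  split_ifs <;> ring

theorem eq_one_of_weight_eq_zero {n : ℕ} {g : Lattice n} (h : ∀ i, weight g i = 0) : g = 1 := by
  have h0 : g.toAdd 0 = 0 := h 0
  refine Multiplicative.toAdd.injective (funext fun i => ?_)
  by_cases hi : i = 0
  · rw [hi]; exact h0
  · have := h i
    rw [weight, if_neg hi, h0] at this
    change g.toAdd i = 0
    omega

theorem exists_weight_eq {n : ℕ} (u : Fin (n + 1) → ℤ) (h : ∀ i, Even (u i - u 0)) :
    ∃ g : Lattice n, ∀ i, weight g i = u i := by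
  choose k hk using h
  refine ⟨Multiplicative.ofAdd fun i => if i = 0 then u 0 else k i, fun i => ?_⟩
  by_cases hi : i = 0
  · rw [hi, weight, if_pos rfl]
    exact Eq.trans (b := if (0 : Fin (n + 1)) = 0 then u 0 else k 0) rfl (if_pos rfl)
  · have := hk i
    rw [weight, if_neg hi]
    change (if (0 : Fin (n + 1)) = 0 then u 0 else k 0) + 2 * (if i = 0 then u 0 else k i) = u i
    rw [if_pos rfl, if_neg hi]
    omega

theorem even_weight_of_parity {n : ℕ} {g : Lattice n} (h : parity n g = 1) (i : Fin (n + 1)) :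
    Even (weight g i) := by
  have := (parity_eq_one_iff g).1 h
  rw [weight]
  split_ifs
  · exact this
  · exact this.add (even_two_mul _)

theorem odd_weight_of_parity {n : ℕ} {g : Lattice n} (h : parity n g = nu) (i : Fin (n + 1)) :
    Odd (weight g i) := by
  have := (parity_eq_nu_iff g).1 h
  rw [weight]
  split_ifs
  · exact this
  · exact this.add_even (even_two_mul _)

theorem parity_of_even_weight {n : ℕ} {g : Lattice n} (h : Even (weight g 0)) : parity n g = 1 :=
  (parity_eq_one_iff g).2 h

/-- The character `m ↦ (-1) ^ m₀`. -/
def latticeSign (n : ℕ) : Lattice n →* ℤˣ :=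
  (zpowersHom ℤˣ (-1)).comp (AddMonoidHom.toMultiplicative (Pi.evalAddMonoidHom _ 0))

theorem latticeSign_apply {n : ℕ} (g : Lattice n) : latticeSign n g = (-1) ^ (g.toAdd 0) := rfl

theorem Zminus_ρ_nu (m : Zminus) : Zminus.ρ nu m = -m :=
  (LinearMap.congr_fun (involutionRep_nu (M := ℤ) (-1) (by simp)) m)

theorem signRep_eq (n : ℕ) (g : Lattice n) (m : ℤ) :
    (Rep.res (parity n) Zminus).ρ g m = (signRep (latticeSign n)).ρ g m := by
  change Zminus.ρ (parity n g) m = (latticeSign n g : ℤ) * m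
  rcases Z2.eq_one_or_nu (parity n g) with h | h
  · rw [h, map_one, latticeSign_apply, ((parity_eq_one_iff g).1 h).neg_one_zpow]
    simp; rfl
  · rw [h, latticeSign_apply, ((parity_eq_nu_iff g).1 h).neg_one_zpow]
    refine (Zminus_ρ_nu m).trans ?_
    simp; rfl

/-- The sign representation is the restriction of `Zminus` along the parity. -/
def resZminusIso (n : ℕ) : Rep.res (parity n) Zminus ≅ signRep (latticeSign n) where
  hom := repHomOfAddMonoidHom (AddMonoidHom.id ℤ) (signRep_eq n)
  inv := repHomOfAddMonoidHom (AddMonoidHom.id ℤ) (fun g m => (signRep_eq n g m).symm)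
  hom_inv_id := rfl
  inv_hom_id := rfl

/-- The Bredon cohomology of a simplicial set whose universal covering is acyclic with the lattice
as its extended deck transformation group. -/
theorem nonempty_bredonCohomology_lattice {n : ℕ} {K : SSet.{0}} {act : Lattice n →* End K}
    {X : Z2SSet} {p : K ⟶ X.K} (h : IsQuotientAlong act (parity n) X p) (hK : IsAcyclic K)
    (hfree : ∀ d (x : K _⦋d⦌) g, (act g).app _ x = x → g = 1) {N : Rep.{0} ℤ Z2} (e : N ≅ Zminus)
    (d : ℕ) : Nonempty (X.bredonCohomology N (d + 1) ≃+ (Fin (n.choose d) → ZMod 2)) := by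
  obtain ⟨i⟩ := h.nonempty_bredonCohomology_iso hK hfree N (d + 1)
  obtain ⟨j⟩ := groupCohomology_sign n (Lattice n) (MulEquiv.refl _) (latticeSign n)
    latticeSign_apply d
  let l : groupCohomology (Rep.res (parity n) N) (d + 1) ≅
      groupCohomology (signRep (latticeSign n)) (d + 1) :=
    (groupCohomology.functor ℤ (Lattice n) (d + 1)).mapIso
      ((Rep.resFunctor (parity n)).mapIso e ≪≫ resZminusIso n)
  exact ⟨(i ≪≫ l).toLinearEquiv.toAddEquiv.trans j⟩

/-! ### Nerves of partially ordered sets -/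

section Nerve

open MonoidalCategory

variable {P Q : Type} [PartialOrder P] [PartialOrder Q]

/-- The simplicial set of weakly increasing sequences in a partially ordered set. -/
abbrev posetNerve (P : Type) [PartialOrder P] : SSet.{0} :=
  PartOrd.nerveFunctor.obj (PartOrd.of P)

/-- The map of nerves induced by a monotone map. -/
abbrev posetNerveMap (f : P →o Q) : posetNerve P ⟶ posetNerve Q :=
  PartOrd.nerveFunctor.map (PartOrd.ofHom f)

/-- The increasing sequence of the vertices of a simplex of the nerve. -/
def nerveVertices {d : SimplexCategoryᵒᵖ} (x : (posetNerve P).obj d) :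
    Fin (d.unop.len + 1) →o P :=
  Functor.toOrderHom (X := Fin (d.unop.len + 1)) (Y := P) x

/-- The simplex with the given vertices. -/
def nerveMk {d : SimplexCategoryᵒᵖ} (s : Fin (d.unop.len + 1) →o P) : (posetNerve P).obj d :=
  s.monotone.functor

theorem nerve_ext {d : SimplexCategoryᵒᵖ} {x y : (posetNerve P).obj d}
    (h : ∀ j, nerveVertices x j = nerveVertices y j) : x = y :=
  CategoryTheory.Functor.ext (C := Fin (d.unop.len + 1)) (D := P) h
    fun _ _ _ => Subsingleton.elim _ _

/-- Comparable monotone maps induce homotopic maps of nerves. -/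
def nerveHomotopy {f g : P →o Q} (h : ∀ x, f x ≤ g x) :
    SSet.Homotopy (posetNerveMap f) (posetNerveMap g) where
  h :=
    { app := fun d => TypeCat.ofHom fun z => nerveMk
        ⟨fun j => if (SSet.stdSimplex.objEquiv z.2).toOrderHom j = 0 then f (nerveVertices z.1 j)
          else g (nerveVertices z.1 j), fun i j hij => by
            have h1 := (nerveVertices z.1).monotone hij
            have h2 := (SSet.stdSimplex.objEquiv z.2).toOrderHom.monotone hij
            dsimp only
            split_ifs with h3 h4 h5
            · exact f.monotone h1
            · exact (f.monotone h1).trans (h _)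
            · exact absurd (le_antisymm (h2.trans_eq h5) (Fin.zero_le _)) h3
            · exact g.monotone h1⟩
      naturality := fun d e φ => by
        ext z
        rfl }
  h₀ := by
    ext d x
    refine nerve_ext fun j => ?_
    exact Eq.trans (b := if (0 : Fin 2) = 0 then f (nerveVertices x j) else
      g (nerveVertices x j)) rfl (if_pos rfl)
  h₁ := by
    ext d x
    refine nerve_ext fun j => ?_
    exact Eq.trans (b := if (1 : Fin 2) = 0 then f (nerveVertices x j) else
      g (nerveVertices x j)) rfl (if_neg (by decide))
  rel := by
    ext d x
    exact x.1.2.elim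

end Nerve

/-! ### The triangulated torus -/

namespace Fence

/-- The point of the infinite fence at an integer; the residue classes modulo `0` are the
integers. -/
def ofInt (a : ℤ) : Fence 0 := ⟨a⟩

/-- The integer of a point of the infinite fence. -/
def toInt (a : Fence 0) : ℤ := a.val

@[simp]
theorem toInt_ofInt (a : ℤ) : (ofInt a).toInt = a := rfl

theorem toInt_injective {a b : Fence 0} (h : a.toInt = b.toInt) : a = b := by
  cases a; cases b; exact congrArg Fence.mk h

theorem le_iff_toInt (a b : Fence 0) : a ≤ b ↔ a.toInt = b.toInt ∨
    (Even a.toInt ∧ ¬ Even b.toInt ∧ (a.toInt - b.toInt = 1 ∨ a.toInt - b.toInt = -1)) := by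
  rw [le_iff]
  exact or_congr ⟨congrArg toInt, toInt_injective⟩ Iff.rfl

/-- Translation of the infinite fence by an even integer. -/
def translate (k : ℤ) (hk : Even k) : Fence 0 →o Fence 0 where
  toFun a := ofInt (a.toInt + k)
  monotone' a b h := by
    rw [le_iff_toInt] at h ⊢
    rw [toInt_ofInt, toInt_ofInt]
    rw [Int.even_iff] at *
    rw [Int.even_iff] at *
    omega

/-- The retraction of the infinite fence onto the interval from `-N` to `N`. -/
def clamp (N : ℕ) : Fence 0 →o Fence 0 where
  toFun a := ofInt (max (-N) (min N a.toInt))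
  monotone' a b h := by
    rw [le_iff_toInt] at h ⊢
    simp only [toInt_ofInt]
    rcases h with h | ⟨h1, h2, h3⟩
    · exact Or.inl (by rw [h])
    · by_cases h4 : max (-(N : ℤ)) (min N a.toInt) = max (-(N : ℤ)) (min N b.toInt)
      · exact Or.inl h4
      · have h5 : max (-(N : ℤ)) (min N a.toInt) = a.toInt := by omega
        have h6 : max (-(N : ℤ)) (min N b.toInt) = b.toInt := by omega
        rw [h5, h6]
        exact Or.inr ⟨h1, h2, h3⟩

theorem toInt_clamp (N : ℕ) (a : Fence 0) : (clamp N a).toInt = max (-(N : ℤ)) (min (N : ℤ) a.toInt) := rfl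

theorem clamp_le_clamp_succ {N : ℕ} (hN : Even N) (a : Fence 0) : clamp N a ≤ clamp (N + 1) a := by
  rw [le_iff_toInt, toInt_clamp, toInt_clamp]
  rw [← Int.even_coe_nat] at hN
  rw [Int.even_iff] at *
  rw [Int.even_iff]
  push_cast
  omega

theorem clamp_succ_le_clamp {N : ℕ} (hN : ¬ Even N) (a : Fence 0) :
    clamp (N + 1) a ≤ clamp N a := by
  rw [le_iff_toInt, toInt_clamp, toInt_clamp]
  rw [← Int.even_coe_nat] at hN
  rw [Int.even_iff] at *
  rw [Int.even_iff]
  push_cast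
  omega

theorem clamp_zero (a : Fence 0) : clamp 0 a = ofInt 0 :=
  toInt_injective (by rw [toInt_clamp, toInt_ofInt]; simp)

theorem clamp_eq_self {N : ℕ} {a : Fence 0} (h : a.toInt.natAbs ≤ N) : clamp N a = a :=
  toInt_injective (by rw [toInt_clamp]; omega)

variable {L : ℕ}

theorem even_intCast_iff (hL : 2 ∣ L) (a : ℤ) : Even (a : ZMod L) ↔ Even a := by
  refine ⟨fun ⟨r, hr⟩ => ?_, fun h => h.map (Int.castRingHom (ZMod L))⟩
  obtain ⟨k, rfl⟩ := ZMod.intCast_surjective r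
  rw [← Int.cast_add, ZMod.intCast_eq_intCast_iff_dvd_sub] at hr
  have : (2 : ℤ) ∣ k + k - a := (Int.natCast_dvd_natCast.2 hL).trans hr
  rw [Int.even_iff]
  omega

/-- Reduction modulo `L`, from the infinite fence to the cyclic one. -/
def reduce (hL : 2 ∣ L) : Fence 0 →o Fence L where
  toFun a := ⟨(a.toInt : ZMod L)⟩
  monotone' a b h := by
    rw [le_iff_toInt] at h
    rcases h with h | ⟨h1, h2, h3⟩
    · exact Or.inl (congrArg (fun m : ℤ => (⟨(m : ZMod L)⟩ : Fence L)) h)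
    · refine Or.inr ⟨(even_intCast_iff hL _).2 h1, fun h => h2 ((even_intCast_iff hL _).1 h), ?_⟩
      rw [← Int.cast_sub]
      rcases h3 with h3 | h3 <;> rw [h3]
      · exact Or.inl (by simp)
      · exact Or.inr (by simp)

theorem reduce_eq_iff (hL : 2 ∣ L) (a b : Fence 0) :
    reduce hL a = reduce hL b ↔ (L : ℤ) ∣ b.toInt - a.toInt := by
  rw [← ZMod.intCast_eq_intCast_iff_dvd_sub]
  exact ⟨congrArg Fence.val, congrArg Fence.mk⟩

theorem reduce_surjective (hL : 2 ∣ L) : Function.Surjective (reduce hL) := fun ⟨b⟩ => by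
  obtain ⟨k, rfl⟩ := ZMod.intCast_surjective b
  exact ⟨ofInt k, rfl⟩

theorem exists_le_reduce_eq (hL : 2 ∣ L) (a : Fence 0) (b : Fence L) (h : reduce hL a ≤ b) :
    ∃ c, a ≤ c ∧ reduce hL c = b := by
  rcases h with rfl | ⟨h1, h2, h3⟩
  · exact ⟨a, le_rfl, rfl⟩
  · have key : ∀ k : ℤ, ((a.toInt : ZMod L)) - b.val = (k : ZMod L) →
        reduce hL (ofInt (a.toInt - k)) = b := fun k hk => by
      cases b
      refine congrArg Fence.mk ?_
      rw [toInt_ofInt, Int.cast_sub, ← hk, sub_sub_cancel]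
    have h1' := (even_intCast_iff hL _).1 h1
    rcases h3 with h3 | h3
    · exact ⟨ofInt (a.toInt - 1), by
        rw [le_iff_toInt, toInt_ofInt]; rw [Int.even_iff] at *; rw [Int.even_iff]; omega,
        key 1 (h3.trans (by simp))⟩
    · exact ⟨ofInt (a.toInt - (-1)), by
        rw [le_iff_toInt, toInt_ofInt]; rw [Int.even_iff] at *; rw [Int.even_iff]; omega,
        key (-1) (h3.trans (by simp))⟩

/-- Comparable pairs with the same reduction differ by a translation: both differences `b - a` and
`b' - a'` are at most `1` in absolute value, and they are congruent modulo `L > 2`. -/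
theorem sub_eq_sub_of_reduce_eq (hL : 4 ∣ L) (hL0 : 0 < L) {a b a' b' : Fence 0} (h : a ≤ b)
    (h' : a' ≤ b') (ha : reduce (dvd_trans (by norm_num) hL) a = reduce (dvd_trans (by norm_num) hL) a')
    (hb : reduce (dvd_trans (by norm_num) hL) b = reduce (dvd_trans (by norm_num) hL) b') :
    b'.toInt - b.toInt = a'.toInt - a.toInt := by
  rw [reduce_eq_iff] at ha hb
  rw [le_iff_toInt] at h h'
  have h4 : (L : ℤ) ∣ (b'.toInt - b.toInt) - (a'.toInt - a.toInt) := dvd_sub hb ha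
  have := Nat.le_of_dvd hL0 hL
  have := Int.eq_zero_of_abs_lt_dvd h4 (by rw [abs_lt]; omega)
  omega

end Fence

/-- A monotone map, applied to each coordinate. -/
def coordinatewise {P Q ι : Type} [PartialOrder P] [PartialOrder Q] (f : ι → (P →o Q)) :
    (ι → P) →o (ι → Q) where
  toFun u i := f i (u i)
  monotone' _ _ h i := (f i).monotone (h i)

/-- The nerve of a power of the infinite fence. -/
abbrev fenceNerve (n : ℕ) : SSet.{0} := posetNerve (Fin n → Fence 0)

/-- The retractions to successive intervals are comparable, in a direction that depends on the parity
of the end points. -/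
theorem nonempty_homotopy_clamp (n N : ℕ) :
    Nonempty (Homotopy
      (chainsMap (posetNerveMap (coordinatewise fun _ : Fin n => Fence.clamp N)))
      (chainsMap (posetNerveMap (coordinatewise fun _ : Fin n => Fence.clamp 0)))) := by
  induction N with
  | zero => exact ⟨Homotopy.refl _⟩
  | succ N ih =>
    obtain ⟨H⟩ := ih
    by_cases hN : Even N
    · exact ⟨(chainsHomotopy (nerveHomotopy fun u i =>
        Fence.clamp_le_clamp_succ hN (u i))).symm.trans H⟩
    · exact ⟨(chainsHomotopy (nerveHomotopy fun u i =>
        Fence.clamp_succ_le_clamp hN (u i))).trans H⟩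

/-- A chain involves finitely many vertices, so it is fixed by the retraction to a large cube. -/
theorem exists_clamp_eq {n d : ℕ} (z : (chains (fenceNerve n)).X d) :
    ∃ N, ∀ M ≥ N, ((chainsMap (posetNerveMap
      (coordinatewise fun _ : Fin n => Fence.clamp M))).f d).hom z = z := by
  let S : AddSubgroup ((chains (fenceNerve n)).X d) :=
    { carrier := {z | ∃ N, ∀ M ≥ N, ((chainsMap (posetNerveMap
        (coordinatewise fun _ : Fin n => Fence.clamp M))).f d).hom z = z}
      zero_mem' := ⟨0, fun M _ => map_zero _⟩
      add_mem' := fun {z z'} ⟨N, hN⟩ ⟨N', hN'⟩ => ⟨max N N', fun M hM => by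
        rw [map_add, hN M (le_trans (le_max_left _ _) hM),
          hN' M (le_trans (le_max_right _ _) hM)]⟩
      neg_mem' := fun {z} ⟨N, hN⟩ => ⟨N, fun M hM => by rw [map_neg, hN M hM]⟩ }
  refine mem_of_forall_cell_mem S (fun x => ?_) z
  refine ⟨Finset.univ.sup fun q : Fin (d + 1) × Fin n =>
    (nerveVertices x q.1 q.2).toInt.natAbs, fun M hM => ?_⟩
  rw [chainsMap_cell]
  refine congrArg cell (nerve_ext fun j => funext fun i => Fence.clamp_eq_self ?_)
  exact (Finset.le_sup (f := fun q : Fin (d + 1) × Fin n =>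
    (nerveVertices x q.1 q.2).toInt.natAbs) (Finset.mem_univ (j, i))).trans hM

theorem mem_degenerate_of_constant {P : Type} [PartialOrder P] {d : ℕ}
    {x : posetNerve P _⦋d + 1⦌} (v : P) (h : ∀ j, nerveVertices x j = v) :
    x ∈ (posetNerve P).degenerate (d + 1) := by
  have : x = (posetNerve P).σ 0 (nerveMk (d := .op ⦋d⦌) (OrderHom.const _ v)) :=
    nerve_ext fun j => h j
  rw [this]
  exact SSet.σ_mem_degenerate _ _ _

theorem isAcyclic_fenceNerve (n : ℕ) : IsAcyclic (fenceNerve n) := by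
  have h0 : ∀ u : Fin n → Fence 0, (coordinatewise fun _ : Fin n => Fence.clamp 0) u =
      fun _ => Fence.ofInt 0 := fun u => funext fun i => Fence.clamp_zero (u i)
  refine isAcyclic_of_homotopy (nerveMk (d := .op ⦋0⦌) (OrderHom.const _ fun _ => Fence.ofInt 0))
    (posetNerveMap (coordinatewise fun _ : Fin n => Fence.clamp 0))
    (fun x => nerve_ext fun j => h0 _)
    (fun d x => mem_degenerate_of_constant _ fun j => h0 _) fun d z => ?_
  obtain ⟨N, hN⟩ := exists_clamp_eq z
  exact ⟨_, hN N le_rfl, nonempty_homotopy_clamp n N⟩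

section Triangulation

variable {L : ℕ} (hL : 4 ∣ L) (n : ℕ)

/-- The translations by which the lattice acts on the power of the infinite fence. -/
def fenceTranslate {n : ℕ} (g : Lattice n) : (Fin (n + 1) → Fence 0) →o (Fin (n + 1) → Fence 0) :=
  coordinatewise fun i => Fence.translate ((L / 2 : ℕ) * weight g i) (by
    refine Even.mul_right ?_ _
    rw [Int.even_coe_nat, even_iff_two_dvd]
    omega)

theorem toInt_fenceTranslate {n : ℕ} (g : Lattice n) (u : Fin (n + 1) → Fence 0)
    (i : Fin (n + 1)) :
    (fenceTranslate hL g u i).toInt = (u i).toInt + (L / 2 : ℕ) * weight g i := rfl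

/-- The action of the lattice on the nerve of the power of the infinite fence. -/
def fenceAct : Lattice n →* End (fenceNerve (n + 1)) where
  toFun g := posetNerveMap (fenceTranslate hL g)
  map_one' := by
    refine NatTrans.ext (funext fun d => ConcreteCategory.hom_ext _ _ fun x => ?_)
    refine nerve_ext fun j => funext fun i => Fence.toInt_injective ?_
    refine (toInt_fenceTranslate hL 1 _ i).trans ?_
    rw [weight_one, mul_zero, add_zero]
    rfl
  map_mul' g h := by
    refine NatTrans.ext (funext fun d => ConcreteCategory.hom_ext _ _ fun x => ?_)
    refine nerve_ext fun j => funext fun i => Fence.toInt_injective ?_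
    refine (toInt_fenceTranslate hL _ _ i).trans ?_
    refine Eq.trans ?_ (toInt_fenceTranslate hL g (fenceTranslate hL h (nerveVertices x j)) i).symm
    rw [weight_mul, mul_add, toInt_fenceTranslate, add_comm ((L / 2 : ℕ) * weight g i), ← add_assoc]
    rfl

variable {n}

theorem fenceAct_free (hL0 : 0 < L) (d : ℕ) (x : fenceNerve (n + 1) _⦋d⦌) (g : Lattice n)
    (h : (fenceAct hL n g).app _ x = x) : g = 1 := by
  refine eq_one_of_weight_eq_zero fun i => ?_
  have h1 : fenceTranslate hL g (nerveVertices x 0) = nerveVertices x 0 :=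
    congrArg (fun y => nerveVertices y 0) h
  have h2 := toInt_fenceTranslate hL g (nerveVertices x 0) i
  rw [h1, left_eq_add] at h2
  refine (mul_eq_zero.1 h2).resolve_left ?_
  have := Nat.le_of_dvd hL0 hL
  omega

/-- Reduction modulo `L` in all coordinates. -/
def fenceReduce (hL : 4 ∣ L) (m : ℕ) : (Fin m → Fence 0) →o (Fin m → Fence L) :=
  coordinatewise fun _ => Fence.reduce (dvd_trans (by norm_num) hL)

theorem fenceReduce_fenceTranslate (g : Lattice n) (u : Fin (n + 1) → Fence 0)
    (i : Fin (n + 1)) : fenceReduce hL (n + 1) (fenceTranslate hL g u) i =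
      if parity n g = nu then (fenceReduce hL (n + 1) u i).shift
      else fenceReduce hL (n + 1) u i := by
  have h0 (k : ℤ) : (((L / 2 : ℕ) * (k + k) : ℤ) : ZMod L) = 0 := by
    rw [ZMod.intCast_zmod_eq_zero_iff_dvd]
    exact ⟨k, by rw [← mul_two, mul_comm k, ← mul_assoc]; congr 1; omega⟩
  split_ifs with h
  · obtain ⟨k, hk⟩ := odd_weight_of_parity h i
    refine congrArg Fence.mk ?_
    rw [toInt_fenceTranslate, hk, two_mul, mul_add, mul_one, Int.cast_add, Int.cast_add, h0,
      zero_add, Int.cast_natCast]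
    rfl
  · obtain ⟨k, hk⟩ := even_weight_of_parity ((Z2.eq_one_or_nu _).resolve_right h) i
    refine congrArg Fence.mk ?_
    rw [toInt_fenceTranslate, hk, Int.cast_add, h0, add_zero]

/-- A simplex of the power of the cyclic fence is lifted by lifting its first vertex, and each other
vertex to a point that lies above the lift of the first one. -/
theorem isQuotientAlong_fenceAct (hL0 : 0 < L) :
    IsQuotientAlong (fenceAct hL n) (parity n) (torusTriangulation L hL (n + 1))
      (posetNerveMap (fenceReduce hL (n + 1))) where
  surjective := parity_surjective n
  comm g d x := by
    refine nerve_ext fun j => funext fun i => ?_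
    refine (fenceReduce_fenceTranslate hL g (nerveVertices x j) i).trans ?_
    split_ifs with h
    · rw [h, Z2SSet.act_nu]
      rfl
    · rw [(Z2.eq_one_or_nu _).resolve_right h, Z2SSet.act_one]
      rfl
  lift d y := by
    have h2 : 2 ∣ L := dvd_trans (by norm_num) hL
    let s : Fin (d + 1) →o (Fin (n + 1) → Fence L) := nerveVertices (d := .op ⦋d⦌) y
    choose v hv using fun i => Fence.reduce_surjective h2 (s 0 i)
    choose c hc hc' using fun j i => Fence.exists_le_reduce_eq h2 (v i) (s j i) (by
      rw [hv]; exact s.monotone (Fin.zero_le j) i)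
    have hmono : Monotone c := by
      intro j k hjk i
      rcases s.monotone hjk i with h | ⟨h1, -, -⟩
      · have := Fence.sub_eq_sub_of_reduce_eq hL hL0 (hc j i) (hc k i) rfl
          ((hc' j i).trans (h.trans (hc' k i).symm))
        refine le_of_eq (Fence.toInt_injective ?_)
        omega
      · have h4 : s 0 i = s j i := by
          rcases s.monotone (Fin.zero_le j) i with h | ⟨-, h, -⟩
          · exact h
          · exact absurd h1 h
        have := Fence.sub_eq_sub_of_reduce_eq hL hL0 (hc j i) (le_refl (v i)) rfl
          ((hc' j i).trans (h4.symm.trans (hv i).symm))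
        have h5 : c j i = v i := Fence.toInt_injective (by omega)
        rw [h5]
        exact hc k i
    exact ⟨nerveMk (d := .op ⦋d⦌) ⟨c, hmono⟩, nerve_ext fun j => funext fun i => hc' j i⟩
  fibre d x y hxy := by
    let s : Fin (d + 1) →o (Fin (n + 1) → Fence 0) := nerveVertices (d := .op ⦋d⦌) x
    let t : Fin (d + 1) →o (Fin (n + 1) → Fence 0) := nerveVertices (d := .op ⦋d⦌) y
    have hst : ∀ j i, Fence.reduce (dvd_trans (by norm_num) hL) (s j i) =
        (Fence.reduce (dvd_trans (by norm_num) hL) (t j i) : Fence L) := fun j i =>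
      congrFun (DFunLike.congr_fun (congrArg nerveVertices hxy) j) i
    choose k hk using fun i => (Fence.reduce_eq_iff (dvd_trans (by norm_num) hL) _ _).1 (hst 0 i)
    obtain ⟨g, hg⟩ := exists_weight_eq (fun i => 2 * k i) fun i => by
      rw [← mul_sub]; exact even_two_mul _
    refine ⟨g, parity_of_even_weight (by rw [hg]; exact even_two_mul _), ?_⟩
    refine nerve_ext fun j => funext fun i => Fence.toInt_injective ?_
    refine (toInt_fenceTranslate hL g (s j) i).trans ?_
    have h1 := Fence.sub_eq_sub_of_reduce_eq hL hL0 (s.monotone (Fin.zero_le j) i)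
      (t.monotone (Fin.zero_le j) i) (hst 0 i) (hst j i)
    have h2 : ((L / 2 : ℕ) : ℤ) * (2 * k i) = L * k i := by
      rw [← mul_assoc]; congr 1; omega
    change (s j i).toInt + _ = (t j i).toInt
    rw [hg, h2, ← hk]
    omega

theorem nonempty_bredonCohomology_torusTriangulation (hL0 : 0 < L) {N : Rep.{0} ℤ Z2}
    (e : N ≅ Zminus) (d : ℕ) :
    Nonempty ((torusTriangulation L hL (n + 1)).bredonCohomology N (d + 1) ≃+
      (Fin (n.choose d) → ZMod 2)) :=
  nonempty_bredonCohomology_lattice (isQuotientAlong_fenceAct hL hL0) (isAcyclic_fenceNerve _)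
    (fenceAct_free hL hL0) e d

end Triangulation

/-! ### The singular simplicial set of the torus -/

theorem exists_circle_lift {Y : Type} [TopologicalSpace Y] [ContractibleSpace Y]
    (f : C(Y, Circle)) : ∃ θ : C(Y, ℝ), ∀ y, Circle.exp (θ y) = f y := by
  obtain ⟨y₀, ⟨H⟩⟩ := id_nullhomotopic Y
  have h0 : ∀ y, (f.comp H.symm.toContinuousMap) (0, y) =
      Circle.exp (ContinuousMap.const Y (Complex.arg (f y₀)) y) := fun y => by
    simp [Circle.exp_arg]
  refine ⟨(Circle.isCoveringMap_exp.liftHomotopy _ _ h0).comp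
    (ContinuousMap.prodMk (ContinuousMap.const Y 1) (ContinuousMap.id Y)), fun y => ?_⟩
  refine (congrFun (Circle.isCoveringMap_exp.liftHomotopy_lifts _ _ h0) (1, y)).trans ?_
  simp

/-- The continuous map given by a singular simplex. -/
def simplexMap {X : Type} [TopologicalSpace X] {d : SimplexCategoryᵒᵖ}
    (x : (TopCat.toSSet.obj (TopCat.of X)).obj d) :
    C(stdSimplex ℝ (Fin (d.unop.len + 1)), X) :=
  TopCat.toSSetObjEquiv (TopCat.of X) d x

/-- The singular simplex given by a continuous map. -/
def simplexMk {X : Type} [TopologicalSpace X] {d : SimplexCategoryᵒᵖ}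
    (f : C(stdSimplex ℝ (Fin (d.unop.len + 1)), X)) : (TopCat.toSSet.obj (TopCat.of X)).obj d :=
  (TopCat.toSSetObjEquiv (TopCat.of X) d).symm f

theorem simplexMap_simplexMk {X : Type} [TopologicalSpace X] {d : SimplexCategoryᵒᵖ}
    (f : C(stdSimplex ℝ (Fin (d.unop.len + 1)), X)) : simplexMap (simplexMk f) = f :=
  (TopCat.toSSetObjEquiv (TopCat.of X) d).apply_symm_apply f

theorem simplex_ext {X : Type} [TopologicalSpace X] {d : SimplexCategoryᵒᵖ}
    {x y : (TopCat.toSSet.obj (TopCat.of X)).obj d}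
    (h : ∀ t, simplexMap x t = simplexMap y t) : x = y :=
  (TopCat.toSSetObjEquiv (TopCat.of X) d).injective (ContinuousMap.ext h)

/-- The map of singular simplicial sets induced by a continuous map. -/
abbrev singularMap {X Y : Type} [TopologicalSpace X] [TopologicalSpace Y] (f : C(X, Y)) :
    TopCat.toSSet.obj (TopCat.of X) ⟶ TopCat.toSSet.obj (TopCat.of Y) :=
  TopCat.toSSet.map (TopCat.ofHom f)

theorem simplex_mem_degenerate_of_constant {X : Type} [TopologicalSpace X] {d : ℕ}
    {x : TopCat.toSSet.obj (TopCat.of X) _⦋d + 1⦌} (v : X) (h : ∀ t, simplexMap x t = v) :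
    x ∈ (TopCat.toSSet.obj (TopCat.of X)).degenerate (d + 1) := by
  have : x = (TopCat.toSSet.obj (TopCat.of X)).σ 0
      (simplexMk (d := .op ⦋d⦌) (ContinuousMap.const _ v)) :=
    simplex_ext fun t => h t
  rw [this]
  exact SSet.σ_mem_degenerate _ _ _

theorem isAcyclic_singular {X : Type} [TopologicalSpace X] [ContractibleSpace X] :
    IsAcyclic (TopCat.toSSet.obj (TopCat.of X)) := by
  obtain ⟨v, ⟨H⟩⟩ := id_nullhomotopic X
  refine isAcyclic_of_homotopy (simplexMk (d := .op ⦋0⦌) (ContinuousMap.const _ v))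
    (singularMap (ContinuousMap.const X v)) (fun x => simplex_ext fun t => rfl)
    (fun d x => simplex_mem_degenerate_of_constant v fun t => rfl) fun d z => ⟨𝟙 _, ?_, ?_⟩
  · rw [chainsMap_id]; rfl
  · have h : SSet.Homotopy (singularMap (ContinuousMap.id X))
        (singularMap (ContinuousMap.const X v)) :=
      TopCat.Homotopy.toSSet (f := TopCat.ofHom (ContinuousMap.id X))
        (g := TopCat.ofHom (ContinuousMap.const X v)) H
    have e : singularMap (ContinuousMap.id X) = 𝟙 _ := TopCat.toSSet.map_id _
    rw [e] at h
    exact ⟨chainsHomotopy h⟩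

/-- The translations by which the lattice acts on the universal covering of the torus. -/
def euclideanTranslate {n : ℕ} (g : Lattice n) : C(Fin (n + 1) → ℝ, Fin (n + 1) → ℝ) :=
  ⟨fun u i => u i + weight g i * Real.pi, by fun_prop⟩

theorem euclideanTranslate_apply {n : ℕ} (g : Lattice n) (u : Fin (n + 1) → ℝ) (i : Fin (n + 1)) :
    euclideanTranslate g u i = u i + weight g i * Real.pi := rfl

/-- The action of the lattice on the singular simplices of the universal covering of the torus. -/
def euclideanAct (n : ℕ) : Lattice n →* End (TopCat.toSSet.obj (TopCat.of (Fin (n + 1) → ℝ))) where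
  toFun g := singularMap (euclideanTranslate g)
  map_one' := by
    refine NatTrans.ext (funext fun d => ConcreteCategory.hom_ext _ _ fun x => ?_)
    refine simplex_ext fun t => funext fun i => ?_
    refine (euclideanTranslate_apply 1 _ i).trans ?_
    rw [weight_one, Int.cast_zero, zero_mul, add_zero]
    rfl
  map_mul' g h := by
    refine NatTrans.ext (funext fun d => ConcreteCategory.hom_ext _ _ fun x => ?_)
    refine simplex_ext fun t => funext fun i => ?_
    refine (euclideanTranslate_apply _ _ i).trans ?_
    refine Eq.trans ?_ (euclideanTranslate_apply g (euclideanTranslate h (simplexMap x t)) i).symm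
    rw [weight_mul, euclideanTranslate_apply, Int.cast_add, add_mul,
      add_comm (weight g i * Real.pi), ← add_assoc]
    rfl

theorem euclideanAct_free {n : ℕ} (d : ℕ)
    (x : TopCat.toSSet.obj (TopCat.of (Fin (n + 1) → ℝ)) _⦋d⦌) (g : Lattice n)
    (h : (euclideanAct n g).app _ x = x) : g = 1 := by
  refine eq_one_of_weight_eq_zero fun i => ?_
  obtain ⟨t⟩ : Nonempty (stdSimplex ℝ (Fin (d + 1))) := inferInstance
  have h1 : euclideanTranslate g (simplexMap x t) = simplexMap x t :=
    congrArg (fun y => simplexMap y t) h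
  have h2 := euclideanTranslate_apply g (simplexMap x t) i
  rw [h1, left_eq_add] at h2
  exact_mod_cast (mul_eq_zero.1 h2).resolve_right Real.pi_ne_zero

/-- The universal covering of the torus. -/
def torusCover (m : ℕ) : C(Fin m → ℝ, Fin m → Circle) :=
  ⟨fun u i => Circle.exp (u i), by fun_prop⟩

theorem torusCover_apply {m : ℕ} (u : Fin m → ℝ) (i : Fin m) :
    torusCover m u i = Circle.exp (u i) := rfl

theorem circle_exp_even_mul_pi {k : ℤ} (hk : Even k) : Circle.exp (k * Real.pi) = 1 := by
  obtain ⟨l, rfl⟩ := hk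
  rw [Circle.exp_eq_one]
  exact ⟨l, by push_cast; ring⟩

theorem circle_exp_odd_mul_pi {k : ℤ} (hk : Odd k) : Circle.exp (k * Real.pi) = -1 := by
  obtain ⟨l, rfl⟩ := hk
  rw [Int.cast_add, add_mul, Circle.exp_add, circle_exp_even_mul_pi (even_two_mul l), one_mul]
  refine Circle.ext ?_
  simp

theorem torusCover_euclideanTranslate {n : ℕ} (g : Lattice n) (u : Fin (n + 1) → ℝ)
    (i : Fin (n + 1)) : torusCover (n + 1) (euclideanTranslate g u) i =
      if parity n g = nu then -torusCover (n + 1) u i else torusCover (n + 1) u i := by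
  rw [torusCover_apply, euclideanTranslate_apply, Circle.exp_add]
  split_ifs with h
  · rw [circle_exp_odd_mul_pi (odd_weight_of_parity h i), mul_neg, mul_one]
    rfl
  · rw [circle_exp_even_mul_pi (even_weight_of_parity ((Z2.eq_one_or_nu _).resolve_right h) i),
      mul_one]
    rfl

theorem isQuotientAlong_euclideanAct (n : ℕ) :
    IsQuotientAlong (euclideanAct n) (parity n) (torus (n + 1))
      (singularMap (torusCover (n + 1))) where
  surjective := parity_surjective n
  comm g d x := by
    refine simplex_ext fun t => funext fun i => ?_
    refine (torusCover_euclideanTranslate g (simplexMap x t) i).trans ?_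
    split_ifs with h
    · rw [h, Z2SSet.act_nu]
      rfl
    · rw [(Z2.eq_one_or_nu _).resolve_right h, Z2SSet.act_one]
      rfl
  lift d y := by
    have : ContractibleSpace (stdSimplex ℝ (Fin (d + 1))) :=
      (convex_stdSimplex ℝ _).contractibleSpace Set.Nonempty.of_subtype
    let s : C(stdSimplex ℝ (Fin (d + 1)), Fin (n + 1) → Circle) := simplexMap (d := .op ⦋d⦌) y
    choose θ hθ using fun i => exists_circle_lift ((ContinuousMap.eval i).comp s)
    refine ⟨simplexMk (d := .op ⦋d⦌) (ContinuousMap.pi θ), simplex_ext fun t => funext fun i => ?_⟩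
    change Circle.exp (simplexMap (simplexMk (d := .op ⦋d⦌) (ContinuousMap.pi θ)) t i) = s t i
    rw [simplexMap_simplexMk]
    exact hθ i t
  fibre d x y hxy := by
    have : ContractibleSpace (stdSimplex ℝ (Fin (d + 1))) :=
      (convex_stdSimplex ℝ _).contractibleSpace Set.Nonempty.of_subtype
    let s : C(stdSimplex ℝ (Fin (d + 1)), Fin (n + 1) → ℝ) := simplexMap (d := .op ⦋d⦌) x
    let r : C(stdSimplex ℝ (Fin (d + 1)), Fin (n + 1) → ℝ) := simplexMap (d := .op ⦋d⦌) y
    have hsr : ∀ t i, Circle.exp (s t i) = Circle.exp (r t i) := fun t i =>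
      congrFun (DFunLike.congr_fun (congrArg simplexMap hxy) t) i
    obtain ⟨t₀⟩ : Nonempty (stdSimplex ℝ (Fin (d + 1))) := inferInstance
    choose k hk using fun i => Circle.exp_eq_one.1
      (show Circle.exp (r t₀ i - s t₀ i) = 1 by rw [Circle.exp_sub, hsr, div_self'])
    obtain ⟨g, hg⟩ := exists_weight_eq (fun i => 2 * k i) fun i => by
      rw [← mul_sub]; exact even_two_mul _
    refine ⟨g, parity_of_even_weight (by rw [hg]; exact even_two_mul _), ?_⟩
    refine simplex_ext fun t => funext fun i => ?_
    refine (euclideanTranslate_apply g (s t) i).trans ?_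
    -- two lifts of the same map to the covering agree since they agree at one point
    have key : (fun t => s t i + weight g i * Real.pi) = fun t => r t i := by
      refine Circle.isCoveringMap_exp.eq_of_comp_eq (by fun_prop) (by fun_prop) ?_ t₀ ?_
      · funext t
        have := circle_exp_even_mul_pi (k := weight g i) (by rw [hg]; exact even_two_mul _)
        simp only [Function.comp_apply]
        rw [Circle.exp_add, this, mul_one, hsr]
      · have := hk i
        rw [hg]
        push_cast
        linarith
    exact congrFun key t

theorem nonempty_bredonCohomology_torus (n : ℕ) {N : Rep.{0} ℤ Z2}
    (e : N ≅ Zminus) (d : ℕ) :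
    Nonempty ((torus (n + 1)).bredonCohomology N (d + 1) ≃+ (Fin (n.choose d) → ZMod 2)) :=
  nonempty_bredonCohomology_lattice (isQuotientAlong_euclideanAct n) isAcyclic_singular
    euclideanAct_free e d

/-! ### The Hopf map and the lifting of homotopies -/

/-- The unit sphere of `ℂ × ℂ` for the supremum norm; it is homeomorphic to the sphere of
dimension three. -/
abbrev S3 : Type := Metric.sphere (0 : ℂ × ℂ) 1

theorem S3.ne_zero (v : S3) : v.1 ≠ 0 := fun h => by
  have := mem_sphere_zero_iff_norm.1 v.2
  rw [h, norm_zero] at this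
  exact zero_ne_one this

/-- The complex number whose real and imaginary parts are the last two coordinates. -/
def S2.tail (x : S2) : ℂ := ⟨x.1 1, x.1 2⟩

open ComplexConjugate

theorem S2.tail_mul_conj (x : S2) : x.tail * conj x.tail = (1 + (x.1 0 : ℂ)) * (1 - (x.1 0 : ℂ)) := by
  have h := (mem_S2_iff x.1).1 x.2
  rw [Complex.mul_conj, Complex.normSq_apply]
  norm_cast
  change x.1 1 * x.1 1 + x.1 2 * x.1 2 = _
  linear_combination h

theorem S2.ext_of_tail {x y : S2} (h0 : x.1 0 = y.1 0) (h : x.tail = y.tail) : x = y := by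
  refine Subtype.ext (PiLp.ext fun i => ?_)
  fin_cases i
  · exact h0
  · exact congrArg Complex.re h
  · exact congrArg Complex.im h

/-- The square of the Euclidean norm. -/
def sqNorm (v : ℂ × ℂ) : ℝ := Complex.normSq v.1 + Complex.normSq v.2

theorem sqNorm_pos {v : ℂ × ℂ} (hv : v ≠ 0) : 0 < sqNorm v := by
  rcases v with ⟨a, b⟩
  have ha := Complex.normSq_nonneg a
  have hb := Complex.normSq_nonneg b
  rcases ha.lt_or_eq with h | h
  · exact add_pos_of_pos_of_nonneg h hb
  · rcases hb.lt_or_eq with h' | h'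
    · exact add_pos_of_nonneg_of_pos ha h'
    · exact absurd (Prod.ext (Complex.normSq_eq_zero.1 h.symm) (Complex.normSq_eq_zero.1 h'.symm)) hv

/-- The Hopf map, from nonzero vectors of `ℂ × ℂ` to the sphere. -/
def hopf (v : {v : ℂ × ℂ // v ≠ 0}) : S2 :=
  ⟨!₂[(Complex.normSq v.1.1 - Complex.normSq v.1.2) / sqNorm v.1,
    2 * (v.1.1 * conj v.1.2).re / sqNorm v.1, 2 * (v.1.1 * conj v.1.2).im / sqNorm v.1], by
    have h := (sqNorm_pos v.2).ne'
    rw [mem_S2_iff]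
    simp only [Matrix.cons_val]
    field_simp
    simp only [sqNorm, Complex.normSq_apply, Complex.mul_re, Complex.mul_im, Complex.conj_re, Complex.conj_im]
    ring⟩

theorem continuous_hopf : Continuous hopf := by
  have hq : Continuous fun v : {v : ℂ × ℂ // v ≠ 0} => sqNorm v.1 := by
    unfold sqNorm
    have := Complex.continuous_normSq
    fun_prop
  have hn := Complex.continuous_normSq
  refine Continuous.subtype_mk ((PiLp.continuous_toLp 2 _).comp (continuous_pi fun i => ?_)) _
  fin_cases i
  · exact Continuous.div (by fun_prop) hq fun v => (sqNorm_pos v.2).ne'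
  · exact Continuous.div (by fun_prop) hq fun v => (sqNorm_pos v.2).ne'
  · exact Continuous.div (by fun_prop) hq fun v => (sqNorm_pos v.2).ne'

theorem hopf_zero (v : {v : ℂ × ℂ // v ≠ 0}) :
    (hopf v).1 0 = (Complex.normSq v.1.1 - Complex.normSq v.1.2) / sqNorm v.1 := rfl

theorem hopf_tail (v : {v : ℂ × ℂ // v ≠ 0}) :
    (hopf v).tail = 2 * (v.1.1 * conj v.1.2) / (sqNorm v.1 : ℂ) := by
  refine Complex.ext ?_ ?_
  · rw [Complex.div_ofReal_re, two_mul, Complex.add_re, ← two_mul]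
    rfl
  · rw [Complex.div_ofReal_im, two_mul, Complex.add_im, ← two_mul]
    rfl

/-- The fibre over `x` is a punctured complex line: the two equations say that `v` is fixed by the
Hermitian involution with rows `(x₀, x.tail)` and `(conj x.tail, -x₀)`. -/
theorem hopf_eq_iff (v : {v : ℂ × ℂ // v ≠ 0}) (x : S2) : hopf v = x ↔
    (1 - (x.1 0 : ℂ)) * v.1.1 = x.tail * v.1.2 ∧
      conj x.tail * v.1.1 = (1 + (x.1 0 : ℂ)) * v.1.2 := by
  obtain ⟨⟨a, b⟩, hv⟩ := v
  have hq : (sqNorm (a, b) : ℂ) = a * conj a + b * conj b := by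
    rw [sqNorm, Complex.ofReal_add, Complex.mul_conj, Complex.mul_conj]
  have hq0 : (sqNorm (a, b) : ℂ) ≠ 0 := Complex.ofReal_ne_zero.2 (sqNorm_pos hv).ne'
  constructor
  · rintro rfl
    have h0 : ((hopf ⟨(a, b), hv⟩).1 0 : ℂ) * sqNorm (a, b) = a * conj a - b * conj b := by
      rw [hopf_zero, Complex.ofReal_div, div_mul_cancel₀ _ hq0, Complex.mul_conj, Complex.mul_conj]
      push_cast; rfl
    have h1 : (hopf ⟨(a, b), hv⟩).tail * sqNorm (a, b) = 2 * (a * conj b) := by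
      rw [hopf_tail, div_mul_cancel₀ _ hq0]
    have h2 : conj (hopf ⟨(a, b), hv⟩).tail * sqNorm (a, b) = 2 * (conj a * b) := by
      have := congrArg conj h1
      simpa [map_ofNat (starRingEnd ℂ) 2] using this
    constructor
    · refine mul_right_cancel₀ hq0 ?_
      simp only
      linear_combination (a : ℂ) * hq - a * h0 - b * h1
    · refine mul_right_cancel₀ hq0 ?_
      simp only
      linear_combination a * h2 - b * h0 - b * hq
  · rintro ⟨h1, h2⟩
    simp only at h1 h2
    have h1' := congrArg conj h1
    have h2' := congrArg conj h2
    simp only [map_mul, map_sub, map_add, map_one, Complex.conj_ofReal, Complex.conj_conj] at h1' h2'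
    refine S2.ext_of_tail ?_ ?_
    · rw [hopf_zero, div_eq_iff (sqNorm_pos hv).ne']
      apply Complex.ofReal_injective
      rw [Complex.ofReal_mul, hq, Complex.ofReal_sub, ← Complex.mul_conj, ← Complex.mul_conj]
      linear_combination a * h1' + conj b * h2
    · rw [hopf_tail, div_eq_iff hq0, hq]
      linear_combination conj b * h1 - a * h2'

/-- The orthogonal projection to the line over a point of the sphere. -/
def lineProjection (x : S2) (v : ℂ × ℂ) : ℂ × ℂ :=
  (((1 + (x.1 0 : ℂ)) * v.1 + x.tail * v.2) / 2, (conj x.tail * v.1 + (1 - (x.1 0 : ℂ)) * v.2) / 2)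

theorem continuous_lineProjection : Continuous fun q : S2 × (ℂ × ℂ) => lineProjection q.1 q.2 := by
  have h : Continuous S2.tail := by
    have : S2.tail = fun x => ((x.1 1 : ℝ) : ℂ) + ((x.1 2 : ℝ) : ℂ) * Complex.I := by
      funext x; exact (Complex.mk_eq_add_mul_I _ _)
    rw [this]
    fun_prop
  unfold lineProjection
  fun_prop

theorem lineProjection_hopf (v : {v : ℂ × ℂ // v ≠ 0}) : lineProjection (hopf v) v.1 = v.1 := by
  obtain ⟨h1, h2⟩ := (hopf_eq_iff v _).1 rfl
  refine Prod.ext ?_ ?_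
  · change (_ : ℂ) / 2 = _
    linear_combination -h1 / 2
  · change (_ : ℂ) / 2 = _
    linear_combination h2 / 2

theorem hopf_lineProjection (x : S2) (v : ℂ × ℂ) (h : lineProjection x v ≠ 0) :
    hopf ⟨lineProjection x v, h⟩ = x := by
  have := x.tail_mul_conj
  rw [hopf_eq_iff]
  constructor
  · simp only [lineProjection]
    linear_combination - v.1 * this / 2
  · simp only [lineProjection]
    linear_combination v.2 * this / 2

theorem lineProjection_ne_zero {x : S2} {v : {v : ℂ × ℂ // v ≠ 0}} (h : x ≠ -hopf v) :
    lineProjection x v.1 ≠ 0 := by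
  intro h0
  refine h ?_
  rw [eq_comm, neg_eq_iff_eq_neg, hopf_eq_iff]
  have h1 := congrArg Prod.fst h0
  have h2 := congrArg Prod.snd h0
  simp only [lineProjection, Prod.fst_zero, Prod.snd_zero] at h1 h2
  have h3 : (-x).1 0 = -x.1 0 := rfl
  have h4 : (-x).tail = -x.tail := by
    refine Complex.ext rfl rfl
  rw [h3, h4]
  push_cast
  rw [map_neg]
  constructor
  · linear_combination 2 * h1
  · linear_combination -2 * h2

/-- The point of the sphere in the direction of a nonzero vector. -/
def S3.normalize (v : {v : ℂ × ℂ // v ≠ 0}) : S3 :=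
  ⟨((‖v.1‖⁻¹ : ℝ) : ℂ) • v.1, by
    rw [mem_sphere_zero_iff_norm, norm_smul, Complex.norm_real, norm_inv, norm_norm,
      inv_mul_cancel₀ (norm_ne_zero_iff.2 v.2)]⟩

theorem S3.continuous_normalize : Continuous S3.normalize := by
  have h : ∀ v : {v : ℂ × ℂ // v ≠ 0}, ‖v.1‖ ≠ 0 := fun v => norm_ne_zero_iff.2 v.2
  unfold S3.normalize
  fun_prop (disch := exact h _)

theorem S3.normalize_coe (v : S3) (h : v.1 ≠ 0) : S3.normalize ⟨v.1, h⟩ = v := by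
  refine Subtype.ext ?_
  change ((‖v.1‖⁻¹ : ℝ) : ℂ) • v.1 = v.1
  rw [mem_sphere_zero_iff_norm.1 v.2]
  simp

/-- The Hopf map on the sphere. -/
def hopfMap : C(S3, S2) :=
  ⟨fun v => hopf ⟨v.1, v.ne_zero⟩, continuous_hopf.comp (by fun_prop)⟩

theorem hopf_smul (c : ℂ) (v : {v : ℂ × ℂ // v ≠ 0}) (h : c • v.1 ≠ 0) :
    hopf ⟨c • v.1, h⟩ = hopf v := by
  obtain ⟨h1, h2⟩ := (hopf_eq_iff v _).1 rfl
  rw [hopf_eq_iff]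
  constructor
  · simp only [Prod.smul_fst, Prod.smul_snd, smul_eq_mul]
    linear_combination c * h1
  · simp only [Prod.smul_fst, Prod.smul_snd, smul_eq_mul]
    linear_combination c * h2

theorem hopfMap_normalize (v : {v : ℂ × ℂ // v ≠ 0}) : hopfMap (S3.normalize v) = hopf v :=
  hopf_smul _ _ _

/-- A lift through the Hopf map of a map `F` is carried to a lift of a map `G` that is nowhere
antipodal to `F` by the orthogonal projections to the lines over `G`. -/
theorem exists_hopf_lift_step {Z : Type} [TopologicalSpace Z] (F G : C(Z, S2)) (w : C(Z, S3))
    (hw : ∀ z, hopfMap (w z) = F z) (hFG : ∀ z, G z ≠ -F z) :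
    ∃ w' : C(Z, S3), (∀ z, hopfMap (w' z) = G z) ∧ ∀ z, G z = F z → w' z = w z := by
  have hne : ∀ z, lineProjection (G z) (w z).1 ≠ 0 := fun z =>
    lineProjection_ne_zero (v := ⟨(w z).1, (w z).ne_zero⟩) (by
      have := hw z
      change hopf _ = _ at this
      rw [this]
      exact hFG z)
  refine ⟨⟨fun z => S3.normalize ⟨lineProjection (G z) (w z).1, hne z⟩,
    S3.continuous_normalize.comp (Continuous.subtype_mk (continuous_lineProjection.comp
      (by fun_prop : Continuous fun z => (G z, (w z).1))) _)⟩, fun z => ?_, fun z hz => ?_⟩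
  · exact (hopfMap_normalize _).trans (hopf_lineProjection _ _ _)
  · have h : lineProjection (G z) (w z).1 = (w z).1 := by
      rw [hz, ← hw z]
      exact lineProjection_hopf ⟨(w z).1, (w z).ne_zero⟩
    refine Eq.trans ?_ (S3.normalize_coe (w z) (w z).ne_zero)
    exact congrArg S3.normalize (Subtype.ext h)

/-- Homotopies lift through the Hopf map, and stay constant where they are constant: by uniform
continuity, the time interval can be cut into steps during which no point moves to its antipode. -/
theorem exists_hopf_homotopy_lift {Y : Type} [PseudoMetricSpace Y] [CompactSpace Y]
    (f : C(Y × I, S2)) (w₀ : C(Y, S3)) (h₀ : ∀ y, hopfMap (w₀ y) = f (y, 0)) :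
    ∃ w : C(Y × I, S3), (∀ z, hopfMap (w z) = f z) ∧
      ∀ y t, (∀ s ≤ t, f (y, s) = f (y, 0)) → w (y, t) = w₀ y := by
  obtain ⟨δ, hδ, hf⟩ := Metric.uniformContinuous_iff.1
    (CompactSpace.uniformContinuous_of_continuous f.continuous) 2 two_pos
  obtain ⟨N, hN⟩ := exists_nat_one_div_lt hδ
  let c : ℕ → I := fun k => Set.projIcc 0 1 zero_le_one ((k : ℝ) / (N + 1))
  let F : ℕ → C(Y × I, S2) := fun k =>
    f.comp ⟨fun z => (z.1, min z.2 (c k)), by fun_prop⟩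
  have hF : ∀ k z, F (k + 1) z ≠ -F k z := by
    rintro k ⟨y, t⟩ h
    have h1 : dist (y, min t (c (k + 1))) (y, min t (c k)) < δ := by
      rw [Prod.dist_eq, dist_self, max_eq_right dist_nonneg]
      refine lt_of_le_of_lt ?_ hN
      have h3 : dist (min t (c (k + 1))) (min t (c k)) ≤ dist (c (k + 1)) (c k) := by
        have hm : ∀ a b : I, ((min a b : I) : ℝ) = min (a : ℝ) b := fun a b =>
          Monotone.map_min (f := fun x : I => (x : ℝ)) fun _ _ h => h
        rw [Subtype.dist_eq, Subtype.dist_eq, Real.dist_eq, Real.dist_eq, hm, hm]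
        refine (abs_min_sub_min_le_max _ _ _ _).trans ?_
        rw [sub_self, abs_zero, max_eq_right (abs_nonneg _)]
      refine h3.trans ((Set.abs_projIcc_sub_projIcc _).trans_eq ?_)
      rw [← sub_div, Nat.cast_add, Nat.cast_one, add_sub_cancel_left]
      exact abs_of_pos (by positivity)
    have h2 := hf h1
    change f (y, min t (c (k + 1))) = - f (y, min t (c k)) at h
    rw [h, Subtype.dist_eq, dist_eq_norm] at h2
    have h4 := mem_sphere_zero_iff_norm.1 (f (y, min t (c k))).2
    change ‖-(f (y, min t (c k))).1 - (f (y, min t (c k))).1‖ < 2 at h2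
    rw [← neg_add', norm_neg, ← two_smul ℝ, norm_smul, h4] at h2
    norm_num at h2
  have key : ∀ k, ∃ w : C(Y × I, S3), (∀ z, hopfMap (w z) = F k z) ∧
      ∀ y t, (∀ s ≤ t, f (y, s) = f (y, 0)) → w (y, t) = w₀ y := by
    intro k
    induction k with
    | zero =>
      refine ⟨w₀.comp ⟨Prod.fst, continuous_fst⟩, fun z => (h₀ z.1).trans ?_, fun _ _ _ => rfl⟩
      have : min z.2 (c 0) = 0 := by
        have : c 0 = 0 := by simp [c, Set.projIcc_left]
        rw [this]
        exact min_eq_right bot_le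
      exact congrArg (fun s => f (z.1, s)) this.symm
    | succ k ih =>
      obtain ⟨w, hw, hw'⟩ := ih
      obtain ⟨w', h1, h2⟩ := exists_hopf_lift_step (F k) (F (k + 1)) w hw (hF k)
      refine ⟨w', h1, fun y t ht => (h2 _ ?_).trans (hw' y t ht)⟩
      exact (ht _ (min_le_left _ _)).trans (ht _ (min_le_left _ _)).symm
  obtain ⟨w, hw, hw'⟩ := key (N + 1)
  refine ⟨w, fun z => (hw z).trans ?_, hw'⟩
  have : c (N + 1) = 1 := by
    simp only [c, Nat.cast_add, Nat.cast_one]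
    rw [div_self (by positivity)]
    exact Set.projIcc_right _
  change f (z.1, min z.2 (c (N + 1))) = f z
  rw [this, min_eq_left (show z.2 ≤ 1 from z.2.2.2)]

/-! ### The degree of a spherical map -/

/-- The fibre of the Hopf map over the base point. -/
def S3.ofCircle (z : Circle) : S3 :=
  ⟨((z : ℂ), 0), by rw [mem_sphere_zero_iff_norm, Prod.norm_mk, norm_zero, Circle.norm_coe]; simp⟩

theorem basePoint_zero : basePoint.1 0 = 1 := rfl

theorem basePoint_tail : basePoint.tail = 0 := rfl

theorem hopfMap_ofCircle (z : Circle) : hopfMap (S3.ofCircle z) = basePoint := by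
  refine (hopf_eq_iff ⟨(S3.ofCircle z).1, _⟩ _).2 ?_
  rw [basePoint_zero, basePoint_tail]
  simp [S3.ofCircle]

theorem exists_eq_ofCircle {v : S3} (h : hopfMap v = basePoint) : ∃ z, v = S3.ofCircle z := by
  have h1 := ((hopf_eq_iff ⟨v.1, v.ne_zero⟩ _).1 h).2
  rw [basePoint_zero, basePoint_tail] at h1
  have hb : v.1.2 = 0 := by
    simp only [map_zero, zero_mul, Complex.ofReal_one] at h1
    refine (mul_eq_zero.1 h1.symm).resolve_left ?_
    norm_num
  have ha : ‖v.1.1‖ = 1 := by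
    have := mem_sphere_zero_iff_norm.1 v.2
    rw [Prod.norm_def, hb, norm_zero, max_eq_left (norm_nonneg _)] at this
    exact this
  exact ⟨⟨v.1.1, mem_sphere_zero_iff_norm.2 ha⟩, Subtype.ext (Prod.ext rfl hb)⟩

theorem exists_eq_ofCircle_comp {Y : Type} [TopologicalSpace Y] (w : C(Y, S3))
    (h : ∀ y, hopfMap (w y) = basePoint) : ∃ μ : C(Y, Circle), ∀ y, w y = S3.ofCircle (μ y) := by
  choose μ hμ using fun y => exists_eq_ofCircle (h y)
  have h1 : ∀ y, ((μ y : Circle) : ℂ) = (w y).1.1 := fun y => by rw [hμ y]; rfl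
  refine ⟨⟨μ, ?_⟩, hμ⟩
  have h2 : μ = fun y => ⟨(w y).1.1, by rw [← h1 y]; exact (μ y).2⟩ :=
    funext fun y => Circle.ext (h1 y)
  rw [h2]
  exact Continuous.subtype_mk (by fun_prop) _

/-- A spherical map has degree `m` if it has a lift `w` through the Hopf map that is constant on the
three sides `u 0 = 0`, `u 1 = 0` and `u 1 = 1` of the square, and winds `m` times around the fibre
over the base point along the side `u 0 = 1`. The winding is measured by a continuous choice `θ` of
the angle along this side. -/
def HasDegree (f : Ω^ (Fin 2) S2 basePoint) (m : ℤ) : Prop :=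
  ∃ (w : C(I^ Fin 2, S3)) (θ : C(I, ℝ)), (∀ u, hopfMap (w u) = f u) ∧
    (∀ u, u 0 = 0 ∨ u 1 = 0 ∨ u 1 = 1 → w u = S3.ofCircle 1) ∧
    (∀ u, u 0 = 1 → w u = S3.ofCircle (Circle.exp (θ (u 1)))) ∧
    θ 0 = 0 ∧ θ 1 = m * (2 * Real.pi)

instance : ContractibleSpace I :=
  (convex_Icc (0 : ℝ) 1).contractibleSpace ⟨0, by simp⟩

theorem constant_of_exp_eq_one (ψ : C(I, ℝ)) (h : ∀ t, Circle.exp (ψ t) = 1) : ψ 0 = ψ 1 := by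
  have := Circle.isCoveringMap_exp.eq_of_comp_eq (g₁ := ψ) (g₂ := fun _ => ψ 0)
    ψ.continuous continuous_const (funext fun t => (h t).trans (h 0).symm) 0 rfl
  exact (congrFun this 1).symm

theorem circle_ofCircle_injective : Function.Injective S3.ofCircle := fun _ _ h =>
  Circle.ext (congrArg (fun v : S3 => v.1.1) h)

theorem exists_hasDegree (f : Ω^ (Fin 2) S2 basePoint) : ∃ m, HasDegree f m := by
  let F : C(I × I, S2) := f.1.comp ⟨fun z => ![z.2, z.1], by
    refine continuous_pi fun i => ?_
    fin_cases i
    · exact continuous_snd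
    · exact continuous_fst⟩
  have hF : ∀ y x, F (y, x) = f ![x, y] := fun _ _ => rfl
  have hb : ∀ y x, x = 0 ∨ x = 1 ∨ y = 0 ∨ y = 1 → F (y, x) = basePoint := by
    intro y x h
    rw [hF]
    refine f.2 _ ?_
    rcases h with h | h | h | h
    · exact ⟨0, Or.inl h⟩
    · exact ⟨0, Or.inr h⟩
    · exact ⟨1, Or.inl h⟩
    · exact ⟨1, Or.inr h⟩
  obtain ⟨w, hw, hw'⟩ := exists_hopf_homotopy_lift F (ContinuousMap.const I (S3.ofCircle 1))
    fun y => (hopfMap_ofCircle 1).trans (hb y 0 (Or.inl rfl)).symm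
  obtain ⟨μ, hμ⟩ := exists_eq_ofCircle_comp
    (w.comp ⟨fun y : I => (y, 1), by fun_prop⟩) fun y =>
      (hw (y, 1)).trans (hb y 1 (Or.inr (Or.inl rfl)))
  obtain ⟨η, hη⟩ := exists_circle_lift μ
  have hside : ∀ y t, y = 0 ∨ y = 1 → w (y, t) = S3.ofCircle 1 := fun y t h => hw' y t fun s _ => by
    rw [hb y s (Or.inr (Or.inr h)), hb y 0 (Or.inl rfl)]
  have hμ1 : ∀ y, y = 0 ∨ y = 1 → μ y = 1 := fun y h =>
    circle_ofCircle_injective ((hμ y).symm.trans (hside y 1 h))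
  have hη1 : Circle.exp (η 1 - η 0) = 1 := by
    rw [Circle.exp_sub, hη, hη, hμ1 0 (Or.inl rfl), hμ1 1 (Or.inr rfl), div_one]
  obtain ⟨m, hm⟩ := Circle.exp_eq_one.1 hη1
  refine ⟨m, w.comp ⟨fun u => (u 1, u 0), by fun_prop⟩, ⟨fun t => η t - η 0, by fun_prop⟩,
    fun u => ?_, fun u hu => ?_, fun u hu => ?_, sub_self _, hm⟩
  · refine (hw (u 1, u 0)).trans ((hF _ _).trans (congrArg f ?_))
    funext i
    fin_cases i <;> rfl
  · change w (u 1, u 0) = _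
    rcases hu with hu | hu
    · rw [hu]
      exact hw' _ _ fun s hs => by rw [le_antisymm hs bot_le]
    · exact hside _ _ hu
  · change w (u 1, u 0) = S3.ofCircle (Circle.exp (η (u 1) - η 0))
    rw [hu, Circle.exp_sub, hη, hη, hμ1 0 (Or.inl rfl), div_one]
    exact hμ (u 1)

theorem HasDegree.of_homotopic {f g : Ω^ (Fin 2) S2 basePoint} (h : GenLoop.Homotopic f g) {m : ℤ}
    (hf : HasDegree f m) : HasDegree g m := by
  obtain ⟨H⟩ := h
  obtain ⟨w, θ, h1, h2, h3, h4, h5⟩ := hf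
  obtain ⟨W, hW, hW'⟩ := exists_hopf_homotopy_lift
    (H.toContinuousMap.comp ⟨fun z : (I^ Fin 2) × I => (z.2, z.1), by fun_prop⟩) w fun u =>
      (h1 u).trans (H.map_zero_left u).symm
  have hbd : ∀ u ∈ Cube.boundary (Fin 2), W (u, 1) = w u := fun u hu => hW' u 1 fun s _ => by
    change H (s, u) = H (0, u)
    rw [H.eq_fst s hu, H.eq_fst 0 hu]
  refine ⟨W.comp ⟨fun u => (u, 1), by fun_prop⟩, θ, fun u => (hW (u, 1)).trans ?_, fun u hu => ?_,
    fun u hu => ?_, h4, h5⟩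
  · exact H.map_one_left u
  · refine (hbd u ?_).trans (h2 u hu)
    rcases hu with hu | hu | hu
    · exact ⟨0, Or.inl hu⟩
    · exact ⟨1, Or.inl hu⟩
    · exact ⟨1, Or.inr hu⟩
  · exact (hbd u ⟨0, Or.inr hu⟩).trans (h3 u hu)

/-- A lift of the constant map runs in the fibre over the base point, and is therefore a null homotopy
there of its own restriction to the boundary of the square. -/
theorem HasDegree.eq_zero {f : Ω^ (Fin 2) S2 basePoint} (hf : ∀ u, f u = basePoint) {m : ℤ}
    (h : HasDegree f m) : m = 0 := by
  obtain ⟨w, θ, h1, h2, h3, h4, h5⟩ := h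
  obtain ⟨μ, hμ⟩ := exists_eq_ofCircle_comp
    (w.comp ⟨fun z : I × I => ![z.1, z.2], by
      refine continuous_pi fun i => ?_
      fin_cases i
      · exact continuous_fst
      · exact continuous_snd⟩) fun z => (h1 _).trans (hf _)
  obtain ⟨η, hη⟩ := exists_circle_lift μ
  have hμ1 : ∀ x y : I, x = 0 ∨ y = 0 ∨ y = 1 → Circle.exp (η (x, y)) = 1 := fun x y hxy => by
    rw [hη]
    exact circle_ofCircle_injective ((hμ (x, y)).symm.trans (h2 ![x, y] hxy))
  have e1 := constant_of_exp_eq_one ⟨fun t => η (0, t), by fun_prop⟩ fun t => hμ1 _ _ (Or.inl rfl)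
  have e2 := constant_of_exp_eq_one ⟨fun t => η (t, 0), by fun_prop⟩ fun t =>
    hμ1 _ _ (Or.inr (Or.inl rfl))
  have e3 := constant_of_exp_eq_one ⟨fun t => η (t, 1), by fun_prop⟩ fun t =>
    hμ1 _ _ (Or.inr (Or.inr rfl))
  have e4 := constant_of_exp_eq_one ⟨fun t => η (1, t) - θ t, by fun_prop⟩ fun t => by
    change Circle.exp (η (1, t) - θ t) = 1
    rw [Circle.exp_sub, hη, div_eq_one]
    exact circle_ofCircle_injective ((hμ (1, t)).symm.trans (h3 ![1, t] rfl))
  simp only [ContinuousMap.coe_mk] at e1 e2 e3 e4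
  have h6 : (m : ℝ) * (2 * Real.pi) = 0 := by linarith
  exact_mod_cast (mul_eq_zero.1 h6).resolve_right (by positivity)

/-- The based antipodal map is covered by the complex conjugation of `ℂ × ℂ`, which reverses the
winding around the fibre. -/
theorem HasDegree.basedAntipode {f : Ω^ (Fin 2) S2 basePoint} {m : ℤ} (h : HasDegree f m) :
    HasDegree (genLoopMap basedAntipode basedAntipode_basePoint f) (-m) := by
  obtain ⟨w, θ, h1, h2, h3, h4, h5⟩ := h
  let c : C(S3, S3) := ⟨fun v => ⟨(starRingEnd ℂ v.1.1, starRingEnd ℂ v.1.2), by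
    have := mem_sphere_zero_iff_norm.1 v.2
    rw [Prod.norm_def] at this
    rw [mem_sphere_zero_iff_norm, Prod.norm_mk, RCLike.norm_conj, RCLike.norm_conj]
    exact this⟩, by
      have := Complex.continuous_conj
      fun_prop⟩
  have hc : ∀ z, c (S3.ofCircle z) = S3.ofCircle z⁻¹ := fun z =>
    Subtype.ext (Prod.ext (Circle.coe_inv_eq_conj z).symm (map_zero _))
  have hc' : ∀ v, hopfMap (c v) = BredonTorus.basedAntipode (hopfMap v) := fun v => by
    obtain ⟨e1, e2⟩ := (hopf_eq_iff ⟨v.1, v.ne_zero⟩ (hopfMap v)).1 rfl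
    refine (hopf_eq_iff ⟨(c v).1, _⟩ _).2 ?_
    have e3 : (BredonTorus.basedAntipode (hopfMap v)).1 0 = (hopfMap v).1 0 := by
      simp [BredonTorus.basedAntipode, rotation, antipode]
    have e4 : (BredonTorus.basedAntipode (hopfMap v)).tail = starRingEnd ℂ (hopfMap v).tail := by
      refine Complex.ext ?_ ?_
      · change (BredonTorus.basedAntipode (hopfMap v)).1 1 = (hopfMap v).1 1
        simp [BredonTorus.basedAntipode, rotation, antipode]
      · change (BredonTorus.basedAntipode (hopfMap v)).1 2 = -(hopfMap v).1 2
        simp [BredonTorus.basedAntipode, rotation, antipode]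
    rw [e3, e4]
    have e1' := congrArg (starRingEnd ℂ) e1
    have e2' := congrArg (starRingEnd ℂ) e2
    simp only [map_mul, map_sub, map_add, map_one, Complex.conj_ofReal] at e1' e2'
    exact ⟨e1', e2'⟩
  refine ⟨c.comp w, -θ, fun u => ?_, fun u hu => ?_, fun u hu => ?_, ?_, ?_⟩
  · exact (hc' _).trans (congrArg _ (h1 u))
  · change c (w u) = _
    rw [h2 u hu, hc, inv_one]
  · change c (w u) = S3.ofCircle (Circle.exp (-θ (u 1)))
    rw [h3 u hu, hc, Circle.exp_neg]
  · change -θ 0 = 0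
    rw [h4, neg_zero]
  · change -θ 1 = _
    rw [h5]; push_cast; ring

/-- The lifts can be concatenated, since they agree on the common side, and the angles add up. -/
theorem HasDegree.transAt {f g : Ω^ (Fin 2) S2 basePoint} {m n : ℤ} (hf : HasDegree f m)
    (hg : HasDegree g n) : HasDegree (GenLoop.transAt 1 f g) (m + n) := by
  obtain ⟨w, θ, h1, h2, h3, h4, h5⟩ := hf
  obtain ⟨v, η, k1, k2, k3, k4, k5⟩ := hg
  let p : ℝ → I := Set.projIcc 0 1 zero_le_one
  have hp : Continuous p := continuous_projIcc
  have hp0 : ∀ x ≤ 0, p x = 0 := fun x hx => Set.projIcc_of_le_left _ hx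
  have hp1 : ∀ x ≥ 1, p x = 1 := fun x hx => Set.projIcc_of_right_le _ hx
  let α : (I^ Fin 2) → (I^ Fin 2) := fun u => Function.update u 1 (p (2 * u 1))
  let β : (I^ Fin 2) → (I^ Fin 2) := fun u => Function.update u 1 (p (2 * u 1 - 1))
  have hα : Continuous α := continuous_id.update 1 (hp.comp (by fun_prop))
  have hβ : Continuous β := continuous_id.update 1 (hp.comp (by fun_prop))
  have hα0 : ∀ u, α u 0 = u 0 := fun u => Function.update_of_ne (by decide) _ _
  have hβ0 : ∀ u, β u 0 = u 0 := fun u => Function.update_of_ne (by decide) _ _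
  have hα1 : ∀ u, α u 1 = p (2 * u 1) := fun u => Function.update_self _ _ _
  have hβ1 : ∀ u, β u 1 = p (2 * u 1 - 1) := fun u => Function.update_self _ _ _
  refine ⟨⟨fun u => if (u 1 : ℝ) ≤ 1 / 2 then w (α u) else v (β u), ?_⟩,
    ⟨fun y => if (y : ℝ) ≤ 1 / 2 then θ (p (2 * y)) else θ 1 + η (p (2 * y - 1)), ?_⟩,
    fun u => ?_, fun u hu => ?_, fun u hu => ?_, ?_, ?_⟩
  · refine Continuous.if_le (by fun_prop) (by fun_prop) (by fun_prop) continuous_const fun u hu => ?_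
    rw [h2 (α u) (Or.inr (Or.inr ((hα1 u).trans (hp1 _ (by rw [hu]; norm_num))))),
      k2 (β u) (Or.inr (Or.inl ((hβ1 u).trans (hp0 _ (by rw [hu]; norm_num)))))]
  · refine Continuous.if_le (by fun_prop) (by fun_prop) (by fun_prop) continuous_const fun y hy => ?_
    rw [hp1 _ (by rw [hy]; norm_num), hp0 _ (by rw [hy]; norm_num), k4, add_zero]
  · change hopfMap (if (u 1 : ℝ) ≤ 1 / 2 then w (α u) else v (β u)) =
      if (u 1 : ℝ) ≤ 1 / 2 then f (α u) else g (β u)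
    split_ifs
    · exact h1 _
    · exact k1 _
  · change (if (u 1 : ℝ) ≤ 1 / 2 then w (α u) else v (β u)) = _
    split_ifs with hc
    · rcases hu with hu | hu | hu
      · exact h2 _ (Or.inl ((hα0 u).trans hu))
      · exact h2 _ (Or.inr (Or.inl ((hα1 u).trans (hp0 _ (by rw [hu]; simp)))))
      · rw [hu] at hc
        norm_num at hc
    · rcases hu with hu | hu | hu
      · exact k2 _ (Or.inl ((hβ0 u).trans hu))
      · rw [hu] at hc
        norm_num at hc
      · exact k2 _ (Or.inr (Or.inr ((hβ1 u).trans (hp1 _ (by rw [hu]; norm_num)))))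
  · change (if (u 1 : ℝ) ≤ 1 / 2 then w (α u) else v (β u)) = S3.ofCircle (Circle.exp
      (if (u 1 : ℝ) ≤ 1 / 2 then θ (p (2 * u 1)) else θ 1 + η (p (2 * u 1 - 1))))
    split_ifs with hc
    · rw [h3 _ ((hα0 u).trans hu), hα1]
    · rw [k3 _ ((hβ0 u).trans hu), hβ1, Circle.exp_add, h5,
        Circle.exp_eq_one.2 ⟨m, rfl⟩, one_mul]
  · change (if ((0 : I) : ℝ) ≤ 1 / 2 then θ (p (2 * (0 : I))) else _) = 0
    rw [if_pos (by simp), hp0 _ (by simp), h4]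
  · change (if ((1 : I) : ℝ) ≤ 1 / 2 then _ else θ 1 + η (p (2 * (1 : I) - 1))) = _
    rw [if_neg (by norm_num), hp1 _ (by norm_num), h5, k5]
    push_cast; ring

/-- A lift of a map of degree one is the normalization of
`(x, y) ↦ ((1 - x) + x exp (2π i y), x (1 - x) y (1 - y))`. The second coordinate vanishes only on
the boundary of the square, where the first has absolute value one; it winds once around the fibre
for `x = 1`, and is `1` on the other sides. -/
theorem exists_hasDegree_one : ∃ f : Ω^ (Fin 2) S2 basePoint, HasDegree f 1 := by
  let a : (I^ Fin 2) → ℂ := fun u =>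
    ((1 - (u 0 : ℝ) : ℝ) : ℂ) + ((u 0 : ℝ) : ℂ) * Circle.exp ((u 1 : ℝ) * (2 * Real.pi))
  let b : (I^ Fin 2) → ℂ := fun u =>
    (((u 0 : ℝ) * (1 - u 0) * ((u 1 : ℝ) * (1 - u 1)) : ℝ) : ℂ)
  have ha1 : ∀ u, u 0 = 0 ∨ u 1 = 0 ∨ u 1 = 1 → a u = 1 := by
    rintro u (hu | hu | hu) <;> simp [a, hu]
  have ha2 : ∀ u, u 0 = 1 → a u = Circle.exp ((u 1 : ℝ) * (2 * Real.pi)) := by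
    intro u hu
    simp [a, hu]
  have h0 : ∀ u, (a u, b u) ≠ 0 := by
    intro u h
    have ha : a u = 0 := congrArg Prod.fst h
    have hb : (u 0 : ℝ) * (1 - u 0) * ((u 1 : ℝ) * (1 - u 1)) = 0 :=
      Complex.ofReal_eq_zero.1 (congrArg Prod.snd h)
    have hb' : (u 0 = 0 ∨ u 1 = 0 ∨ u 1 = 1) ∨ u 0 = 1 := by
      simp only [mul_eq_zero, sub_eq_zero, Set.Icc.coe_eq_zero, eq_comm (a := (1 : ℝ)),
        Set.Icc.coe_eq_one] at hb
      tauto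
    rcases hb' with hu | hu
    · rw [ha1 u hu] at ha
      exact one_ne_zero ha
    · rw [ha2 u hu] at ha
      exact Circle.coe_ne_zero _ ha
  let w : C(I^ Fin 2, S3) := ⟨fun u => S3.normalize ⟨(a u, b u), h0 u⟩,
    S3.continuous_normalize.comp (Continuous.subtype_mk (by fun_prop) _)⟩
  have hw : ∀ u (z : Circle), a u = z → b u = 0 → w u = S3.ofCircle z := by
    intro u z hz hb
    refine Eq.trans ?_ (S3.normalize_coe (S3.ofCircle z) (S3.ne_zero _))
    exact congrArg S3.normalize (Subtype.ext (Prod.ext hz hb))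
  have hw1 : ∀ u, u 0 = 0 ∨ u 1 = 0 ∨ u 1 = 1 → w u = S3.ofCircle 1 := by
    intro u hu
    refine hw u 1 (ha1 u hu) ?_
    rcases hu with hu | hu | hu <;> simp [b, hu]
  have hw2 : ∀ u, u 0 = 1 → w u = S3.ofCircle (Circle.exp ((u 1 : ℝ) * (2 * Real.pi))) := by
    intro u hu
    exact hw u _ (ha2 u hu) (by simp [b, hu])
  refine ⟨⟨hopfMap.comp w, fun u hu => ?_⟩, w, ⟨fun y => (y : ℝ) * (2 * Real.pi), by fun_prop⟩,
    fun _ => rfl, hw1, hw2, by simp, by simp⟩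
  change hopfMap (w u) = basePoint
  obtain ⟨i, hi⟩ := hu
  have : (u 0 = 0 ∨ u 1 = 0 ∨ u 1 = 1) ∨ u 0 = 1 := by
    fin_cases i
    · exact hi.elim (fun h => Or.inl (Or.inl h)) Or.inr
    · exact Or.inl (Or.inr hi)
  rcases this with h | h
  · rw [hw1 u h, hopfMap_ofCircle]
  · rw [hw2 u h, hopfMap_ofCircle]

/-! ### Maps of the square to the sphere of dimension three -/

/-- Maps to the nonzero vectors that are joined by nowhere vanishing segments are homotopic. -/
theorem homotopicRel_normalize {Z : Type} [TopologicalSpace Z] {S : Set Z} (f g : C(Z, ℂ × ℂ))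
    (h : ∀ z, ∀ t : I, (1 - (t : ℝ)) • f z + (t : ℝ) • g z ≠ 0) (hS : ∀ z ∈ S, f z = g z)
    (F G : C(Z, S3)) (hF : ∀ z h, F z = S3.normalize ⟨f z, h⟩)
    (hG : ∀ z h, G z = S3.normalize ⟨g z, h⟩) : F.HomotopicRel G S := by
  have e0 : ∀ z, (1 - ((0 : I) : ℝ)) • f z + ((0 : I) : ℝ) • g z = f z := fun z => by simp
  have e1 : ∀ z, (1 - ((1 : I) : ℝ)) • f z + ((1 : I) : ℝ) • g z = g z := fun z => by simp
  refine ⟨⟨⟨⟨fun q => S3.normalize ⟨(1 - (q.1 : ℝ)) • f q.2 + (q.1 : ℝ) • g q.2, h q.2 q.1⟩,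
    S3.continuous_normalize.comp (Continuous.subtype_mk (by fun_prop) _)⟩, fun z => ?_,
    fun z => ?_⟩, fun t z hz => ?_⟩⟩
  · rw [hF z (by rw [← e0 z]; exact h z 0)]
    exact congrArg S3.normalize (Subtype.ext (e0 z))
  · rw [hG z (by rw [← e1 z]; exact h z 1)]
    exact congrArg S3.normalize (Subtype.ext (e1 z))
  · rw [hF z (by rw [← e0 z]; exact h z 0)]
    refine congrArg S3.normalize (Subtype.ext ?_)
    change (1 - (t : ℝ)) • f z + (t : ℝ) • g z = f z
    rw [← hS z hz, ← add_smul, sub_add_cancel, one_smul]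

/-- A continuous cutoff of small vectors that moves no vector by more than `1 / 5`. -/
def cutoff (v : ℂ × ℂ) : ℝ := min 1 (max 0 (10 * ‖v‖ - 1))

theorem cutoff_eq_zero {v : ℂ × ℂ} (h : ‖v‖ ≤ 1 / 10) : cutoff v = 0 := by
  rw [cutoff, max_eq_left (by linarith), min_eq_right zero_le_one]

theorem norm_cutoff_smul_sub_le (v : ℂ × ℂ) : ‖cutoff v • v - v‖ ≤ 1 / 5 := by
  have h1 : cutoff v • v - v = -((1 - cutoff v) • v) := by rw [sub_smul, one_smul, neg_sub]
  have h0 : 0 ≤ cutoff v := le_min zero_le_one (le_max_left _ _)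
  have h2 : 0 ≤ 1 - cutoff v := sub_nonneg.2 (min_le_left _ _)
  rw [h1, norm_neg, norm_smul, Real.norm_of_nonneg h2]
  by_cases h : ‖v‖ ≤ 1 / 5
  · exact (mul_le_of_le_one_left (norm_nonneg v) (by linarith)).trans h
  · have : cutoff v = 1 := by
      rw [cutoff, min_eq_left]
      exact le_max_of_le_right (by linarith)
    rw [this, sub_self, zero_mul]
    norm_num

/-- Every map of the square to the sphere that is constant on the boundary is null homotopic: a
smooth approximation, moved slightly, avoids the ray opposite to the base point, since this
ray and the square have together less than four dimensions. -/
theorem homotopicRel_const (w : C(I^ Fin 2, S3))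
    (hw : ∀ u ∈ Cube.boundary (Fin 2), w u = S3.ofCircle 1) :
    w.HomotopicRel (ContinuousMap.const _ (S3.ofCircle 1)) (Cube.boundary (Fin 2)) := by
  let v₀ : ℂ × ℂ := (S3.ofCircle 1).1
  let p : ℝ → I := Set.projIcc 0 1 zero_le_one
  have hp : Continuous p := continuous_projIcc
  have hp' : ∀ t : I, p t = t := fun t => Set.projIcc_val zero_le_one t
  -- the difference of `w` and its boundary value, extended from the square to the plane
  let U : ℝ × ℝ → ℂ × ℂ := fun q => (w ![p q.1, p q.2]).1 - v₀
  have hU : Continuous U := by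
    have : Continuous fun q : ℝ × ℝ => ![p q.1, p q.2] := by
      refine continuous_pi fun i => ?_
      fin_cases i
      · exact hp.comp continuous_fst
      · exact hp.comp continuous_snd
    fun_prop
  have hU' : ∀ u : I^ Fin 2, U (u 0, u 1) = (w u).1 - v₀ := fun u => by
    have : ![p (u 0), p (u 1)] = u := by
      funext i
      fin_cases i
      · exact hp' _
      · exact hp' _
    change (w ![p (u 0), p (u 1)]).1 - v₀ = _
    rw [this]
  obtain ⟨g, hg, hgU, -⟩ := hU.exists_contDiff_approx 1 (ε := fun _ => 1 / 20) continuous_const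
    fun _ => by norm_num
  -- after translation by `e`, the smooth approximation misses the line spanned by `v₀`
  have hdense : Dense (Set.range fun q : ℝ × (ℝ × ℝ) => -(q.1 • v₀) - g q.2)ᶜ := by
    refine ContDiff.dense_compl_range_of_finrank_lt_finrank ?_ ?_
    · have : ContDiff ℝ 1 g := by exact_mod_cast hg
      fun_prop
    · rw [Module.finrank_prod, Module.finrank_prod, Module.finrank_prod, Module.finrank_self,
        Complex.finrank_real_complex]
      norm_num
  obtain ⟨e, he, hed⟩ := hdense.exists_dist_lt 0 (show (0 : ℝ) < 1 / 20 by norm_num)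
  rw [dist_zero_left] at hed
  let k : C(I^ Fin 2, ℂ × ℂ) := ⟨fun u => g (u 0, u 1) + e, by
    have := hg.continuous
    fun_prop⟩
  have hk : ∀ u, ‖k u - ((w u).1 - v₀)‖ ≤ 1 / 10 := fun u => by
    have h1 := hgU (u 0, u 1)
    rw [hU', dist_eq_norm] at h1
    change ‖g (u 0, u 1) + e - ((w u).1 - v₀)‖ ≤ 1 / 10
    rw [add_sub_right_comm]
    refine (norm_add_le _ _).trans ?_
    linarith
  -- the cutoff restores the boundary values and leaves the direction of `k` unchanged
  let w' : C(I^ Fin 2, ℂ × ℂ) := ⟨fun u => v₀ + cutoff (k u) • k u, by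
    unfold cutoff
    fun_prop⟩
  have hw' : ∀ u, ‖w' u - (w u).1‖ ≤ 3 / 10 := fun u => by
    have : w' u - (w u).1 = (cutoff (k u) • k u - k u) + (k u - ((w u).1 - v₀)) := by
      change v₀ + cutoff (k u) • k u - (w u).1 = _
      abel
    rw [this]
    refine (norm_add_le _ _).trans ((add_le_add (norm_cutoff_smul_sub_le _) (hk u)).trans ?_)
    norm_num
  have hw0 : ∀ u ∈ Cube.boundary (Fin 2), w' u = v₀ := fun u hu => by
    have h1 := hk u
    rw [hw u hu, sub_self, sub_zero] at h1
    change v₀ + cutoff (k u) • k u = v₀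
    rw [cutoff_eq_zero h1, zero_smul, add_zero]
  have hne : ∀ u, w' u ≠ 0 := fun u h => by
    have h1 := hw' u
    rw [h, zero_sub, norm_neg, mem_sphere_zero_iff_norm.1 (w u).2] at h1
    norm_num at h1
  let W : C(I^ Fin 2, S3) := ⟨fun u => S3.normalize ⟨w' u, hne u⟩,
    S3.continuous_normalize.comp (by fun_prop)⟩
  refine (homotopicRel_normalize ⟨fun u => (w u).1, by fun_prop⟩ w' ?_ ?_ w W ?_ ?_).trans
    (homotopicRel_normalize w' (ContinuousMap.const _ v₀) ?_ ?_ W _ ?_ ?_)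
  · intro u t h
    have h1 : (w u).1 = -((t : ℝ) • (w' u - (w u).1)) := by
      refine eq_neg_iff_add_eq_zero.2 (Eq.trans ?_ h)
      change (w u).1 + (t : ℝ) • (w' u - (w u).1) = (1 - (t : ℝ)) • (w u).1 + (t : ℝ) • w' u
      rw [sub_smul, smul_sub, one_smul]
      abel
    have h2 := mem_sphere_zero_iff_norm.1 (w u).2
    rw [h1, norm_neg, norm_smul, Real.norm_of_nonneg t.2.1] at h2
    have := mul_le_of_le_one_left (norm_nonneg (w' u - (w u).1)) t.2.2
    have := hw' u
    linarith
  · intro u hu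
    change (w u).1 = w' u
    rw [hw0 u hu, hw u hu]
  · intro u h
    exact (S3.normalize_coe (w u) h).symm
  · intro u h
    rfl
  · intro u t h
    let c : ℝ := (1 - t) * cutoff (k u)
    have h1 : v₀ + c • k u = 0 := by
      refine Eq.trans ?_ h
      change v₀ + ((1 - (t : ℝ)) * cutoff (k u)) • k u =
        (1 - (t : ℝ)) • (v₀ + cutoff (k u) • k u) + (t : ℝ) • v₀
      rw [smul_add, smul_smul, sub_smul, one_smul]
      abel
    have hc : c ≠ 0 := fun hc => by
      rw [hc, zero_smul, add_zero] at h1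
      exact S3.ne_zero _ h1
    refine he ⟨(c⁻¹, (u 0, u 1)), ?_⟩
    have h2 : k u = -(c⁻¹ • v₀) := by
      rw [eq_neg_iff_add_eq_zero, ← smul_right_injective _ hc |>.eq_iff]
      simp only [smul_add, smul_smul, mul_inv_cancel₀ hc, one_smul, smul_zero]
      rw [add_comm]
      exact h1
    change -(c⁻¹ • v₀) - g (u 0, u 1) = e
    rw [← h2]
    exact add_sub_cancel_left _ _
  · exact hw0
  · intro u h
    rfl
  · intro u h
    exact (S3.normalize_coe (S3.ofCircle 1) h).symm

/-- A spherical map of degree zero is null homotopic: its lift can be unwound to a map that is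
constant on the boundary. -/
theorem HasDegree.homotopic_const {f : Ω^ (Fin 2) S2 basePoint} (h : HasDegree f 0) :
    GenLoop.Homotopic f GenLoop.const := by
  obtain ⟨w, θ, h1, h2, h3, h4, h5⟩ := h
  have key : ∀ u, ((Circle.exp (-((u 0 : ℝ) * θ (u 1))) : Circle) : ℂ) • (w u).1 ≠ 0 := fun u =>
    smul_ne_zero (Circle.coe_ne_zero _) (w u).ne_zero
  let v : C(I^ Fin 2, S3) := ⟨fun u => S3.normalize
    ⟨((Circle.exp (-((u 0 : ℝ) * θ (u 1))) : Circle) : ℂ) • (w u).1, key u⟩,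
    S3.continuous_normalize.comp (Continuous.subtype_mk (by fun_prop) _)⟩
  have hv : ∀ u, hopfMap (v u) = f u := fun u =>
    (hopfMap_normalize _).trans ((hopf_smul _ ⟨(w u).1, (w u).ne_zero⟩ _).trans (h1 u))
  have hvb : ∀ u ∈ Cube.boundary (Fin 2), v u = S3.ofCircle 1 := by
    intro u hu
    refine Eq.trans (congrArg S3.normalize (Subtype.ext ?_))
      (S3.normalize_coe (S3.ofCircle 1) (S3.ne_zero _))
    have hu' : u 0 = 1 ∨ u 0 = 0 ∨ u 1 = 0 ∨ u 1 = 1 := by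
      obtain ⟨i, hi⟩ := hu
      fin_cases i
      · exact hi.elim (fun h => Or.inr (Or.inl h)) Or.inl
      · exact Or.inr (Or.inr hi)
    change ((Circle.exp (-((u 0 : ℝ) * θ (u 1))) : Circle) : ℂ) • (w u).1 = (S3.ofCircle 1).1
    rcases hu' with hu' | hu'
    · rw [h3 u hu', hu']
      refine Prod.ext ?_ (smul_zero _)
      change ((Circle.exp (-(((1 : I) : ℝ) * θ (u 1))) : Circle) : ℂ) *
        (Circle.exp (θ (u 1)) : Circle) = ((1 : Circle) : ℂ)
      rw [← Circle.coe_mul, ← Circle.exp_add]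
      simp
    · have : (u 0 : ℝ) * θ (u 1) = 0 := by
        rcases hu' with hu' | hu' | hu'
        · rw [hu']; simp
        · rw [hu', h4, mul_zero]
        · rw [hu', h5]; simp
      rw [h2 u hu', this]
      simp
  have e : f.1 = hopfMap.comp v := ContinuousMap.ext fun u => (hv u).symm
  have e' : (GenLoop.const : Ω^ (Fin 2) S2 basePoint).1 =
      hopfMap.comp (ContinuousMap.const _ (S3.ofCircle 1)) :=
    ContinuousMap.ext fun u => (hopfMap_ofCircle 1).symm
  change f.1.HomotopicRel (GenLoop.const : Ω^ (Fin 2) S2 basePoint).1 _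
  rw [e, e']
  exact (homotopicRel_const v hvb).comp_continuousMap hopfMap

/-! ### The second homotopy group of the sphere -/

/-- A class in the second homotopy group has degree `m` if it is represented by a spherical map of
degree `m`. -/
def ClassHasDegree (c : π_ 2 S2 basePoint) (m : ℤ) : Prop :=
  ∃ f : Ω^ (Fin 2) S2 basePoint, Quotient.mk _ f = c ∧ HasDegree f m

theorem exists_classHasDegree (c : π_ 2 S2 basePoint) : ∃ m, ClassHasDegree c m := by
  obtain ⟨f, rfl⟩ := Quotient.exists_rep c
  obtain ⟨m, hm⟩ := exists_hasDegree f
  exact ⟨m, f, rfl, hm⟩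

theorem ClassHasDegree.mul {c c' : π_ 2 S2 basePoint} {m m' : ℤ} (h : ClassHasDegree c m)
    (h' : ClassHasDegree c' m') : ClassHasDegree (c * c') (m + m') := by
  obtain ⟨f, rfl, hf⟩ := h
  obtain ⟨g, rfl, hg⟩ := h'
  -- the product of the classes of `f` and `g` is represented by `g` followed by `f`
  refine ⟨GenLoop.transAt 1 g f, (HomotopyGroup.mul_spec (i := (1 : Fin 2))).symm, ?_⟩
  rw [add_comm]
  exact hg.transAt hf

theorem ClassHasDegree.eq_zero {m : ℤ} (h : ClassHasDegree 1 m) : m = 0 := by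
  obtain ⟨f, hf, h⟩ := h
  have hf' : GenLoop.Homotopic f GenLoop.const := Quotient.exact hf
  exact (h.of_homotopic hf').eq_zero fun _ => rfl

theorem ClassHasDegree.unique {c : π_ 2 S2 basePoint} {m m' : ℤ} (h : ClassHasDegree c m)
    (h' : ClassHasDegree c m') : m = m' := by
  obtain ⟨k, hk⟩ := exists_classHasDegree c⁻¹
  have h1 := h.mul hk
  have h2 := h'.mul hk
  rw [mul_inv_cancel] at h1 h2
  exact add_right_cancel (h1.eq_zero.trans h2.eq_zero.symm)

theorem ClassHasDegree.eq_one {c : π_ 2 S2 basePoint} (h : ClassHasDegree c 0) : c = 1 := by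
  obtain ⟨f, rfl, hf⟩ := h
  exact Quotient.sound hf.homotopic_const

theorem ClassHasDegree.pi2Involution {c : Additive (π_ 2 S2 basePoint)} {m : ℤ}
    (h : ClassHasDegree c.toMul m) : ClassHasDegree (pi2Involution c).toMul (-m) := by
  obtain ⟨f, hf, h⟩ := h
  refine ⟨_, ?_, h.basedAntipode⟩
  obtain rfl : Additive.ofMul (Quotient.mk _ f : π_ 2 S2 basePoint) = c := hf
  rfl

/-- The degree of a class in the second homotopy group of the sphere. -/
def degree : Additive (π_ 2 S2 basePoint) →+ ℤ :=
  AddMonoidHom.mk' (fun c => (exists_classHasDegree c.toMul).choose) fun c c' =>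
    (exists_classHasDegree (c + c').toMul).choose_spec.unique
      ((exists_classHasDegree c.toMul).choose_spec.mul (exists_classHasDegree c'.toMul).choose_spec)

theorem classHasDegree_degree (c : Additive (π_ 2 S2 basePoint)) :
    ClassHasDegree c.toMul (degree c) :=
  (exists_classHasDegree c.toMul).choose_spec

theorem degree_bijective : Function.Bijective degree := by
  refine ⟨(injective_iff_map_eq_zero degree).2 fun c hc => ?_, fun m => ?_⟩
  · have := classHasDegree_degree c
    rw [hc] at this
    exact this.eq_one
  · obtain ⟨f, hf⟩ := exists_hasDegree_one
    let c : Additive (π_ 2 S2 basePoint) := Additive.ofMul (Quotient.mk _ f : π_ 2 S2 basePoint)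
    have h1 : degree c = 1 := (classHasDegree_degree c).unique ⟨f, rfl, hf⟩
    exact ⟨m • c, by rw [map_zsmul, h1, smul_eq_mul, mul_one]⟩

theorem degree_pi2Involution (c : Additive (π_ 2 S2 basePoint)) :
    degree (pi2Involution c) = -degree c :=
  (classHasDegree_degree _).unique (classHasDegree_degree c).pi2Involution

theorem degree_ρ (g : Z2) (c : pi2S2) : degree (pi2S2.ρ g c) = Zminus.ρ g (degree c) := by
  rcases Z2.eq_one_or_nu g with rfl | rfl
  · rw [map_one, map_one]
    rfl
  · refine Eq.trans ?_ (Zminus_ρ_nu (degree c)).symm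
    refine Eq.trans (congrArg degree ?_) (degree_pi2Involution c)
    exact LinearMap.congr_fun (involutionRep_nu pi2Involution pi2Involution_mul_self) c

/-- The second homotopy group of the sphere is the sign module of `ℤ/2`. -/
def pi2S2Iso : pi2S2 ≅ Zminus :=
  let e : Additive (π_ 2 S2 basePoint) ≃+ ℤ := AddEquiv.ofBijective degree degree_bijective
  { hom := repHomOfAddMonoidHom (A := pi2S2) (B := Zminus) degree degree_ρ
    inv := repHomOfAddMonoidHom (A := Zminus) (B := pi2S2) e.symm.toAddMonoidHom fun g m => by
      refine e.injective ((e.apply_symm_apply _).trans ?_)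
      refine Eq.trans ?_ (degree_ρ g (e.symm m)).symm
      exact congrArg (Zminus.ρ g) (e.apply_symm_apply m).symm
    hom_inv_id := Rep.hom_ext (DFunLike.ext _ _ fun c => e.symm_apply_apply c)
    inv_hom_id := Rep.hom_ext (DFunLike.ext _ _ fun m => e.apply_symm_apply m) }

end

end BredonTorus

theorem mainTheorem6 :
    Nonempty (BredonTorus.pi2S2 ≅ BredonTorus.Zminus) ∧
    ∀ n d : ℕ, 1 ≤ n → 1 ≤ d →
      Nonempty ((BredonTorus.torus n).bredonCohomology BredonTorus.pi2S2 d ≃+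
        (Fin ((n - 1).choose (d - 1)) → ZMod 2)) ∧
      ∀ (L : ℕ) (hL : 4 ∣ L), 0 < L →
        Nonempty ((BredonTorus.torusTriangulation L hL n).bredonCohomology BredonTorus.pi2S2 d ≃+
          (Fin ((n - 1).choose (d - 1)) → ZMod 2)) := by
  have e := BredonTorus.pi2S2Iso
  refine ⟨⟨e⟩, fun n d hn hd => ?_⟩
  obtain ⟨n, rfl⟩ := Nat.exists_eq_add_of_le' hn
  obtain ⟨d, rfl⟩ := Nat.exists_eq_add_of_le' hd
  exact ⟨BredonTorus.nonempty_bredonCohomology_torus n e d, fun L hL hL0 =>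
    BredonTorus.nonempty_bredonCohomology_torusTriangulation hL hL0 e d⟩
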